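/- Let $F$ be a non-archimedean local field with ring of integers $\mathfrak o$, maximal ideal $\mathfrak p=\varpi\mathfrak o$ and $q=|\mathfrak o/\mathfrak p|$. Put $G=\mathrm{GL}_2(F)$ and $K=\mathrm{GL}_2(\mathfrak o)$, give $F$ and $G$ the Haar measures with $\mathrm{vol}(\mathfrak o)=1$ and $\mathrm{vol}(K)=1$, and let $*$ be convolution on $G$. Let $C_c^\infty(G/\!/K)$ be the space of compactly supported locally constant $K$-bi-invariant functions $G\to\mathbb C$, and let $C_{ac}^\infty(G/\!/K)$ be the space of locally constant $K$-bi-invariant functions whose restriction to $\{g:\det g\in C\}$ is compactly supported for every compact $C\subset F^\times$ (almost compactly supported functions). A series of functions on $G$ is said to converge in the almost compactly supported sense if, for every compact $C\subset F^\times$, only finitely many of its terms are not identically zero on $\{g:\det g\in C\}$; its sum is then the pointwise sum. The Satake transform of $f\in C_c^\infty(G/\!/K)$ is $$\mathcal S(f)=\sum_{a,b\in\mathbb Z}\Big(q^{(b-a)/2}\int_F f\Big(\begin{pmatrix}\varpi^a&\\&\varpi^b\end{pmatrix}\begin{pmatrix}1&x\\&1\end{pmatrix}\Big)dx\Big)\,t_1^a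 t_2^b .$$ It is a bijection $\mathcal S:C_c^\infty(G/\!/K)\to\mathbb C[t_1^{\pm1},t_2^{\pm1}]^{S_2}$, where $S_2$ switches $t_1$ and $t_2$. Let $\mathcal S^{-1}$ be its inverse, let $\mathrm{Sym}^j(\mathrm{Sym}^3(t_1,t_2))$ denote the complete homogeneous symmetric polynomial of degree $j$ evaluated at $t_1^3,\ t_1^2t_2,\ t_1t_2^2,\ t_2^3$, and set $$\mathbb L(\mathrm{Sym}^3)=\sum_{j=0}^\infty\mathcal S^{-1}\big(\mathrm{Sym}^j(\mathrm{Sym}^3(t_1,t_2))\big).$$ For $m\ge 0$ and $i\in\mathbb Z$ let $$\mathbb 1_m=\sum_{\substack{a\ge b\ge 0\\ a+b=m}}\mathbb 1_{K\left(\begin{smallmatrix}\varpi^a&\\&\varpi^b\end{smallmatrix}\right)K},\qquad \mathbb 1_{i,i}=\mathbb 1_{K\left(\begin{smallmatrix}\varpi^i&\\&\varpi^i\end{smallmatrix}\right)K},$$ and for $j\ge 0$ let $$T_j=\sum_{n=0}^{\lfloor 3j/2\rfloor}\Big(\Big\lfloor\frac n2\Big\rfloor-\Big\lfloor\frac{n-1}3\Big\rfloor\Big)q^n\,\mathbb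 1_{3j-2n}*\mathbb 1_{n,n}-\sum_{n=j+1}^{\lfloor 3j/2\rfloor}\Big(\Big\lfloor\frac{n-j-1}2\Big\rfloor+1\Big)q^n\,\mathbb 1_{3j-2n}*\mathbb 1_{n,n}.$$ **Theorem.** The series defining $\mathbb L(\mathrm{Sym}^3)$ converges in the almost compactly supported sense, $\mathbb L(\mathrm{Sym}^3)\in C_{ac}^\infty(G/\!/K)$, and $$\mathbb L(\mathrm{Sym}^3)=\sum_{j=0}^\infty T_j\,q^{-3j/2},$$ where the series on the right also converges in the almost compactly supported sense. -/

import Mathlib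

open MeasureTheory
open scoped ValuativeRel

noncomputable section

namespace SymPowerBasic

/-! ### The group `GL₂` over a non-archimedean local field -/

/-- The maximal compact subgroup `K = GL₂(𝔬)` of `GL₂(F)`. -/
def maxCompact (F : Type*) [Field F] [ValuativeRel F] : Subgroup (GL (Fin 2) F) :=
  (Matrix.GeneralLinearGroup.map (n := Fin 2) (algebraMap 𝒪[F] F)).range

/-- The residue cardinality `q = |𝔬/𝔭|`. -/
def residueCard (F : Type*) [Field F] [ValuativeRel F] : ℕ := Nat.card 𝓀[F]

/-- `ϖ` is a generator of the maximal ideal `𝔭` of `𝔬`. -/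
def IsUniformizer {F : Type*} [Field F] [ValuativeRel F] (ϖ : Fˣ) : Prop :=
  ∃ p : 𝒪[F], (p : F) = (ϖ : F) ∧ 𝓂[F] = Ideal.span {p}

/-- The diagonal matrix `diag(x, y)`. -/
def diagGL {F : Type*} [Field F] (x y : Fˣ) : GL (Fin 2) F where
  val := !![(x : F), 0; 0, (y : F)]
  inv := !![((x⁻¹ : Fˣ) : F), 0; 0, ((y⁻¹ : Fˣ) : F)]
  val_inv := by simp [Matrix.one_fin_two]
  inv_val := by simp [Matrix.one_fin_two]

/-- The unipotent matrix with rows `(1, x)` and `(0, 1)`. -/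
def unipotent {F : Type*} [Field F] (x : F) : GL (Fin 2) F where
  val := !![1, x; 0, 1]
  inv := !![1, -x; 0, 1]
  val_inv := by simp [Matrix.one_fin_two]
  inv_val := by simp [Matrix.one_fin_two]

/-! ### Spherical Hecke algebras -/

/-- Locally constant `K`-bi-invariant functions on `GL₂(F)`. -/
def sphericalFunctions (F : Type*) [Field F] [ValuativeRel F] [TopologicalSpace F] :
    Set (GL (Fin 2) F → ℂ) :=
  {f | IsLocallyConstant f ∧
    ∀ k₁ ∈ maxCompact F, ∀ k₂ ∈ maxCompact F, ∀ g, f (k₁ * g * k₂) = f g}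

/-- The unramified Hecke algebra `C_c^∞(GL₂(F) // K)` (its underlying set of functions). -/
def sphericalHecke (F : Type*) [Field F] [ValuativeRel F] [TopologicalSpace F] :
    Set (GL (Fin 2) F → ℂ) :=
  {f | f ∈ sphericalFunctions F ∧ HasCompactSupport f}

/-- The space `C_ac^∞(GL₂(F) // K)` of almost compactly supported functions: the restriction to
the set of matrices with determinant in any given compact subset of `Fˣ` is compactly
supported. -/
def acSphericalHecke (F : Type*) [Field F] [ValuativeRel F] [TopologicalSpace F] :
    Set (GL (Fin 2) F → ℂ) :=
  {f | f ∈ sphericalFunctions F ∧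
    ∀ C : Set Fˣ, IsCompact C →
      IsCompact (tsupport f ∩ {g | Matrix.GeneralLinearGroup.det g ∈ C})}

/-- `L` is the sum of the series `∑ⱼ f j` of functions on `GL₂(F)`, in the sense appropriate to
almost compactly supported functions: over each compact set of determinants only finitely many
terms do not vanish, and `L` is the (pointwise finite) sum. -/
def IsAcSum {F : Type*} [Field F] [TopologicalSpace F]
    (f : ℕ → GL (Fin 2) F → ℂ) (L : GL (Fin 2) F → ℂ) : Prop :=
  (∀ C : Set Fˣ, IsCompact C →
    {j | ∃ g, Matrix.GeneralLinearGroup.det g ∈ C ∧ f j g ≠ 0}.Finite) ∧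
  ∀ g, L g = ∑ᶠ j, f j g

/-- Convolution on the group `GL₂(F)` with respect to the measure `μ`. -/
def conv {F : Type*} [Field F] [MeasurableSpace (GL (Fin 2) F)] (μ : Measure (GL (Fin 2) F))
    (f₁ f₂ : GL (Fin 2) F → ℂ) : GL (Fin 2) F → ℂ :=
  fun g => ∫ y, f₁ y * f₂ (y⁻¹ * g) ∂μ

/-- The characteristic function of the double coset `K diag(x, y) K`. -/
def charDouble {F : Type*} [Field F] [ValuativeRel F] (x y : Fˣ) : GL (Fin 2) F → ℂ :=
  Set.indicator (DoubleCoset.doubleCoset (diagGL x y) (maxCompact F) (maxCompact F)) 1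

/-- `𝟙_m`, the sum of the characteristic functions of `K diag(ϖ^a, ϖ^b) K` over all
`a ≥ b ≥ 0` with `a + b = m`. -/
def oneM {F : Type*} [Field F] [ValuativeRel F] (ϖ : Fˣ) (m : ℕ) : GL (Fin 2) F → ℂ :=
  ∑ p ∈ (Finset.HasAntidiagonal.antidiagonal m).filter (fun p : ℕ × ℕ => p.2 ≤ p.1), charDouble (ϖ ^ p.1) (ϖ ^ p.2)

/-- `𝟙_{i,i}`, the characteristic function of `K diag(ϖ^i, ϖ^i) K`. -/
def oneII {F : Type*} [Field F] [ValuativeRel F] (ϖ : Fˣ) (i : ℤ) : GL (Fin 2) F → ℂ :=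
  charDouble (ϖ ^ i) (ϖ ^ i)

/-! ### Laurent polynomials and the Satake transform -/

/-- The Laurent polynomial ring `ℂ[t₁^{±1}, t₂^{±1}]`. -/
abbrev Laurent₂ : Type := AddMonoidAlgebra ℂ (ℤ × ℤ)

/-- The Laurent monomial `t₁^a t₂^b`. -/
def tMonomial (a b : ℤ) : Laurent₂ := AddMonoidAlgebra.single (a, b) 1

/-- `ℂ[t₁^{±1}, t₂^{±1}]^{S₂}`: the Laurent polynomials invariant under switching `t₁`, `t₂`. -/
def symmetricLaurent : Set Laurent₂ :=
  {P | ∀ a b : ℤ, P.coeff (a, b) = P.coeff (b, a)}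

/-- The eigenvalues `t₁^{k-i} t₂^i`, `0 ≤ i ≤ k`, of `Sym^k(diag(t₁, t₂))`. -/
def symEigenvalue (k : ℕ) (i : Fin (k + 1)) : Laurent₂ := tMonomial ((k : ℤ) - (i : ℤ)) (i : ℤ)

/-- `Sym^j(Sym^k(t₁, t₂))`, the trace of `Sym^j(Sym^k)` on `diag(t₁, t₂)`: the sum of all
monomials of degree `j` in the `k + 1` eigenvalues of `Sym^k(diag(t₁, t₂))`. -/
def symSym (j k : ℕ) : Laurent₂ :=
  MvPolynomial.aeval (symEigenvalue k) (MvPolynomial.hsymm (Fin (k + 1)) ℂ j)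

/-- The Satake transform of `f`, given by its family of Laurent coefficients: the coefficient of
`t₁^a t₂^b` is `δ(t)^{1/2} ∫_F f(t n(x)) dx`, where `t = diag(ϖ^a, ϖ^b)`, `n(x)` is the upper
triangular unipotent matrix with entry `x`, and `δ(t) = |ϖ^a / ϖ^b| = q^{b-a}`. -/
def satake {F : Type*} [Field F] [ValuativeRel F] [MeasurableSpace F] (ν : Measure F) (ϖ : Fˣ)
    (f : GL (Fin 2) F → ℂ) : ℤ × ℤ → ℂ :=
  fun p => (((residueCard F : ℝ) ^ (((p.2 : ℝ) - (p.1 : ℝ)) / 2) : ℝ) : ℂ) *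
    ∫ x, f (diagGL (ϖ ^ p.1) (ϖ ^ p.2) * unipotent x) ∂ν

/-- The inverse Satake transform: the element of the unramified Hecke algebra whose Satake
transform is the given Laurent polynomial. -/
def satakeInv {F : Type*} [Field F] [ValuativeRel F] [TopologicalSpace F] [MeasurableSpace F]
    (ν : Measure F) (ϖ : Fˣ) (P : Laurent₂) : GL (Fin 2) F → ℂ :=
  Function.invFunOn (satake ν ϖ) (sphericalHecke F) P.coeff

/-- The basic function `𝕃(Sym^k) = ∑ⱼ 𝒮⁻¹(Sym^j(Sym^k(t₁, t₂)))`, summed pointwise. -/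
def basicFunction {F : Type*} [Field F] [ValuativeRel F] [TopologicalSpace F] [MeasurableSpace F]
    (ν : Measure F) (ϖ : Fˣ) (k : ℕ) : GL (Fin 2) F → ℂ :=
  fun g => ∑ᶠ j : ℕ, satakeInv ν ϖ (symSym j k) g

/-- The Hecke operator
`T_j = ∑_{n=0}^{⌊3j/2⌋} (⌊n/2⌋ - ⌊(n-1)/3⌋) q^n 𝟙_{3j-2n} * 𝟙_{n,n}
  - ∑_{n=j+1}^{⌊3j/2⌋} (⌊(n-j-1)/2⌋ + 1) q^n 𝟙_{3j-2n} * 𝟙_{n,n}`. -/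
def heckeT {F : Type*} [Field F] [ValuativeRel F] [MeasurableSpace (GL (Fin 2) F)]
    (μ : Measure (GL (Fin 2) F)) (ϖ : Fˣ) (j : ℕ) : GL (Fin 2) F → ℂ :=
  (∑ n ∈ Finset.Icc 0 (3 * j / 2),
    (((⌊(n : ℚ) / 2⌋ - ⌊((n : ℚ) - 1) / 3⌋ : ℤ) : ℂ) * (residueCard F : ℂ) ^ n) •
      conv μ (oneM ϖ (3 * j - 2 * n)) (oneII ϖ (n : ℤ)))
  - ∑ n ∈ Finset.Icc (j + 1) (3 * j / 2),
    (((⌊((n : ℚ) - (j : ℚ) - 1) / 2⌋ + 1 : ℤ) : ℂ) * (residueCard F : ℂ) ^ n) •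
      conv μ (oneM ϖ (3 * j - 2 * n)) (oneII ϖ (n : ℤ))

end SymPowerBasic

end

/-!
The proof rests on one basis. For `m ≥ 0` and `i ∈ ℤ` the function `𝟙_m * 𝟙_{i,i}` is the
characteristic function of the matrices with entries in `ϖ ^ i 𝔬` and determinant of valuation
`m + 2 i` (`conv_oneM_oneII`), and the measure of the set of `x` with `ϖ ^ a x ∈ ϖ ^ i 𝔬`
shows that its Satake transform is `q ^ (m / 2) h_m(t₁, t₂) (t₁ t₂) ^ i` (`satake_basisFn`).

A spherical function is determined by its values on the matrices `diag(ϖ ^ a, ϖ ^ b)`, by the Cartan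
decomposition, and these values form a symmetric function of `(a, b)` with finite support. The
restriction of `𝟙_m * 𝟙_{i,i}` to diagonal matrices is the coefficient function of
`h_m(t₁, t₂) (t₁ t₂) ^ i`. So both sides of the Satake transform are spaces of symmetric finitely
supported functions on `ℤ × ℤ`, and everything reduces to the fact that the functions
`h_m(t₁, t₂) (t₁ t₂) ^ i` form a basis of that space: the coordinates of `P` are the differences
`P(m + i, i) - P(m + i + 1, i - 1)` (`schurSum_sub`, `eq_schurSum`). This gives the bijectivity
`satake_bijOn`.

The explicit formula then holds term by term: `q ^ (-3j/2) T_j` is the inverse Satake transform of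
`Sym^j(Sym^3)`. By the description of coordinates as differences, this amounts to counting the
monomials of degree `j` in `t₁³, t₁² t₂, t₁ t₂², t₂³` with degree `n` in `t₂` and subtracting the
number with degree `n - 1`. Replacing a factor `t₁³` by `t₁² t₂` matches most of these with each
other (`ncard_boxTriples_sub`); the unmatched ones of degree `n` and of degree `n - 1` correspond to
the solutions of `2a + 3b = n` and of `a + 2b = n - j - 1`, whose numbers are the two multiplicities
in the definition of `T_j`.

Finally, the `j`-th term is supported on determinants of valuation `3j`. Hence the terms have
disjoint supports, open and closed in `GL₂(F)`, and a compact set of determinants meets finitely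
many of them (`isAcSum_finsum`, `finsum_mem_acSphericalHecke`).
-/

noncomputable section

namespace SymPowerBasic

open ValuativeRel

/-! ### Valuations and measures of the fractional ideals `ϖ ^ n 𝔬` -/

section LocalField

variable {F : Type*} [Field F] [ValuativeRel F]

lemma valuation_unit_eq_one (u : 𝒪[F]ˣ) : valuation F ((u : 𝒪[F]) : F) = 1 := by
  refine le_antisymm (u : 𝒪[F]).2 ?_
  have h1 : valuation F (((u⁻¹ : 𝒪[F]ˣ) : 𝒪[F]) : F) ≤ 1 := ((u⁻¹ : 𝒪[F]ˣ) : 𝒪[F]).2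
  have h2 : ((u : 𝒪[F]) : F) * (((u⁻¹ : 𝒪[F]ˣ) : 𝒪[F]) : F) = 1 := by
    rw [← Subring.coe_mul, Units.mul_inv, Subring.coe_one]
  have h3 := congrArg (valuation F) h2
  rw [map_mul, map_one] at h3
  calc (1 : ValueGroupWithZero F) = _ := h3.symm
    _ ≤ valuation F ((u : 𝒪[F]) : F) * 1 := mul_le_mul_right h1 _
    _ = _ := mul_one _

lemma isUnit_integer_of_valuation_eq_one (x : 𝒪[F]) (hx : valuation F (x : F) = 1) :
    IsUnit x := by
  have h0 : (x : F) ≠ 0 := by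
    rintro h
    simp [h] at hx
  refine IsUnit.of_mul_eq_one ⟨(x : F)⁻¹, ?_⟩ (Subtype.ext (mul_inv_cancel₀ h0))
  change valuation F _ ≤ 1
  rw [map_inv₀, hx, inv_one]

lemma mem_maximalIdeal_iff {ϖ : Fˣ} (hϖ : IsUniformizer ϖ) (x : 𝒪[F]) :
    x ∈ 𝓂[F] ↔ valuation F (x : F) ≤ valuation F (ϖ : F) := by
  obtain ⟨p, hp, hm⟩ := hϖ
  rw [hm, Ideal.mem_span_singleton, ← hp]
  have h0 : (p : F) ≠ 0 := hp ▸ ϖ.ne_zero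
  constructor
  · rintro ⟨c, rfl⟩
    rw [Subring.coe_mul, map_mul]
    exact mul_le_of_le_one_right' c.2
  · intro h
    refine ⟨⟨(x : F) / p, ?_⟩, Subtype.ext (mul_div_cancel₀ _ h0).symm⟩
    change valuation F _ ≤ 1
    rw [map_div₀]
    exact div_le_one_of_le₀ h zero_le

lemma valuation_uniformizer_lt_one {ϖ : Fˣ} (hϖ : IsUniformizer ϖ) :
    valuation F (ϖ : F) < 1 := by
  have h1 : (1 : 𝒪[F]) ∉ 𝓂[F] :=
    (Ideal.ne_top_iff_one _).1 (IsLocalRing.maximalIdeal.isMaximal _).ne_top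
  rw [mem_maximalIdeal_iff hϖ] at h1
  simpa using h1

lemma valuation_zpow_le_iff {ϖ : Fˣ} (hϖ : IsUniformizer ϖ) (a b : ℤ) :
    valuation F (ϖ : F) ^ a ≤ valuation F (ϖ : F) ^ b ↔ b ≤ a :=
  zpow_le_zpow_iff_right_of_lt_one₀ (zero_lt_iff.2 (by simp)) (valuation_uniformizer_lt_one hϖ)

lemma valuation_zpow_inj {ϖ : Fˣ} (hϖ : IsUniformizer ϖ) {a b : ℤ} :
    valuation F (ϖ : F) ^ a = valuation F (ϖ : F) ^ b ↔ a = b := by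
  rw [le_antisymm_iff, valuation_zpow_le_iff hϖ, valuation_zpow_le_iff hϖ]
  omega

variable [TopologicalSpace F] [IsNonarchimedeanLocalField F]

lemma exists_valuation_eq_zpow {ϖ : Fˣ} (hϖ : IsUniformizer ϖ) {x : F} (hx : x ≠ 0) :
    ∃ n : ℤ, valuation F x = valuation F (ϖ : F) ^ n := by
  have key : ∀ y : F, y ≠ 0 → valuation F y ≤ 1 →
      ∃ n : ℤ, valuation F y = valuation F (ϖ : F) ^ n := by
    intro y hy hy1
    obtain ⟨p, hp, hm⟩ := hϖ
    have hirr : Irreducible p := (IsDiscreteValuationRing.irreducible_iff_uniformizer p).2 hm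
    have hy0 : (⟨y, hy1⟩ : 𝒪[F]) ≠ 0 := fun h => hy (congrArg Subtype.val h)
    obtain ⟨n, u, hu⟩ := IsDiscreteValuationRing.associated_pow_irreducible hy0 hirr
    refine ⟨n, ?_⟩
    have h2 := congrArg (fun z : 𝒪[F] => valuation F (z : F)) hu
    simp only [Subring.coe_mul, map_mul, valuation_unit_eq_one, mul_one, Subring.coe_pow, map_pow,
      hp] at h2
    rw [zpow_natCast]
    exact h2
  rcases le_total (valuation F x) 1 with h | h
  · exact key x hx h
  · obtain ⟨n, hn⟩ := key x⁻¹ (inv_ne_zero hx) (by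
      rw [map_inv₀]; exact inv_le_one_of_one_le₀ h)
    refine ⟨-n, ?_⟩
    rw [map_inv₀] at hn
    rw [zpow_neg, ← hn, inv_inv]

instance instT2SpaceLocalField : T2Space F := by
  let := IsTopologicalAddGroup.rightUniformSpace F
  have := isUniformAddGroup_of_addCommGroup (G := F)
  infer_instance

lemma isClopen_valuation_le {γ : ValueGroupWithZero F} (hγ : γ ≠ 0) :
    IsClopen {x : F | valuation F x ≤ γ} := by
  have hopen : IsOpen {x : F | valuation F x ≤ γ} := by
    rw [isOpen_iff_mem_nhds]
    intro x hx
    rw [IsValuativeTopology.mem_nhds_iff']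
    refine ⟨Units.mk0 γ hγ, fun y hy => ?_⟩
    have h1 : valuation F (y - x) < γ := by simpa using hy
    have h2 := (valuation F).map_add (y - x) x
    rw [sub_add_cancel] at h2
    exact h2.trans (max_le h1.le hx)
  refine ⟨?_, hopen⟩
  exact (IsNonarchimedeanLocalField.isCompact_closedBall F γ).isClosed

lemma isClopen_valuation_eq {ϖ : Fˣ} (hϖ : IsUniformizer ϖ) (n : ℤ) :
    IsClopen {x : F | valuation F x = valuation F (ϖ : F) ^ n} := by
  have h0 : ∀ k : ℤ, valuation F (ϖ : F) ^ k ≠ 0 := fun k => zpow_ne_zero _ (by simp)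
  convert (isClopen_valuation_le (h0 n)).diff (isClopen_valuation_le (h0 (n + 1))) using 1
  ext x
  simp only [Set.mem_sdiff, Set.mem_ofPred_eq]
  rcases eq_or_ne x 0 with rfl | hx
  · simp [(h0 n).symm]
  · obtain ⟨k, hk⟩ := exists_valuation_eq_zpow hϖ hx
    rw [hk, valuation_zpow_inj hϖ, valuation_zpow_le_iff hϖ, valuation_zpow_le_iff hϖ]
    omega

/-- A compact subset of `F` lies in some fractional ideal `ϖ ^ (-N) 𝔬`. -/
lemma exists_valuation_le_of_isCompact {ϖ : Fˣ} (hϖ : IsUniformizer ϖ) {S : Set F}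
    (hS : IsCompact S) : ∃ N : ℕ, ∀ x ∈ S, valuation F x ≤ valuation F (ϖ : F) ^ (-(N : ℤ)) := by
  have h0 : ∀ k : ℤ, valuation F (ϖ : F) ^ k ≠ 0 := fun k => zpow_ne_zero _ (by simp)
  obtain ⟨N, hN⟩ := hS.elim_directed_cover
    (fun N : ℕ => {x : F | valuation F x ≤ valuation F (ϖ : F) ^ (-(N : ℤ))})
    (fun N => (isClopen_valuation_le (h0 _)).2) (by
      intro x _
      rw [Set.mem_iUnion]
      rcases eq_or_ne x 0 with rfl | hx
      · exact ⟨0, by simp⟩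
      · obtain ⟨k, hk⟩ := exists_valuation_eq_zpow hϖ hx
        refine ⟨k.natAbs, ?_⟩
        change valuation F x ≤ valuation F (ϖ : F) ^ (-(k.natAbs : ℤ))
        rw [hk, valuation_zpow_le_iff hϖ]
        omega)
    (directed_of_isDirected_le (fun a b hab x hx =>
      show valuation F x ≤ valuation F (ϖ : F) ^ (-(b : ℤ)) from
      le_trans (show valuation F x ≤ valuation F (ϖ : F) ^ (-(a : ℤ)) from hx)
        ((valuation_zpow_le_iff hϖ _ _).2 (by omega))))
  exact ⟨N, hN⟩

/-- The ball `ϖ ^ n 𝔬` is a disjoint union of `q` translates of `ϖ ^ (n + 1) 𝔬`. -/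
lemma measure_ball_eq_mul [MeasurableSpace F] [BorelSpace F] (ν : Measure F) [ν.IsAddHaarMeasure]
    {ϖ : Fˣ} (hϖ : IsUniformizer ϖ) (n : ℤ) :
    ν {x : F | valuation F x ≤ valuation F (ϖ : F) ^ n} =
      residueCard F * ν {x : F | valuation F x ≤ valuation F (ϖ : F) ^ (n + 1)} := by
  classical
  have h0 : ∀ k : ℤ, valuation F (ϖ : F) ^ k ≠ 0 := fun k => zpow_ne_zero _ (by simp)
  have hϖ0 : (ϖ : F) ^ n ≠ 0 := zpow_ne_zero _ ϖ.ne_zero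
  let B : Set F := {x : F | valuation F x ≤ valuation F (ϖ : F) ^ (n + 1)}
  let rep : 𝓀[F] → 𝒪[F] := Function.surjInv (IsLocalRing.residue_surjective (R := 𝒪[F]))
  have hrep : ∀ i, IsLocalRing.residue 𝒪[F] (rep i) = i :=
    Function.surjInv_eq (IsLocalRing.residue_surjective (R := 𝒪[F]))
  let T : 𝓀[F] → Set F := fun i => (fun x => -((rep i : F) * (ϖ : F) ^ n) + x) ⁻¹' B
  have hT : ∀ i x, x ∈ T i ↔ valuation F (x / (ϖ : F) ^ n - rep i) ≤ valuation F (ϖ : F) := by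
    intro i x
    have : -((rep i : F) * (ϖ : F) ^ n) + x = (x / (ϖ : F) ^ n - rep i) * (ϖ : F) ^ n := by
      field_simp
      ring
    change valuation F (-((rep i : F) * (ϖ : F) ^ n) + x) ≤ _ ↔ _
    rw [this, map_mul, map_zpow₀, zpow_add_one₀ (by simp), mul_comm (_ ^ n) (valuation F (ϖ : F))]
    exact mul_le_mul_iff_left₀ (zero_lt_iff.2 (h0 n))
  have hunion : {x : F | valuation F x ≤ valuation F (ϖ : F) ^ n} = ⋃ i, T i := by
    ext x
    rw [Set.mem_iUnion]
    have hx : x ∈ {x : F | valuation F x ≤ valuation F (ϖ : F) ^ n} ↔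
        valuation F (x / (ϖ : F) ^ n) ≤ 1 := by
      rw [map_div₀, map_zpow₀, div_le_one₀ (zero_lt_iff.2 (h0 n))]
      rfl
    rw [hx]
    constructor
    · intro h
      refine ⟨IsLocalRing.residue 𝒪[F] ⟨_, h⟩, ?_⟩
      rw [hT]
      have := (mem_maximalIdeal_iff hϖ
        ((⟨_, h⟩ : 𝒪[F]) - rep (IsLocalRing.residue 𝒪[F] ⟨_, h⟩))).1 (by
          rw [← IsLocalRing.residue_eq_zero_iff, map_sub, hrep, sub_self])
      simpa using this
    · rintro ⟨i, hi⟩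
      rw [hT] at hi
      have h2 := (valuation F).map_add (x / (ϖ : F) ^ n - rep i) (rep i)
      rw [sub_add_cancel] at h2
      exact h2.trans (max_le (hi.trans (valuation_uniformizer_lt_one hϖ).le) (rep i).2)
  have hdisj : Pairwise (Function.onFun Disjoint T) := by
    intro i j hij
    refine Set.disjoint_left.2 fun x hi hj => hij ?_
    rw [hT] at hi hj
    have h3 := (valuation F).map_sub (x / (ϖ : F) ^ n - rep i) (x / (ϖ : F) ^ n - rep j)
    rw [sub_sub_sub_cancel_left] at h3
    have h4 := (mem_maximalIdeal_iff hϖ (rep j - rep i)).2 (by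
      simpa using h3.trans (max_le hi hj))
    rw [← IsLocalRing.residue_eq_zero_iff, map_sub, hrep, hrep, sub_eq_zero] at h4
    exact h4.symm
  have hmeas : ∀ i, MeasurableSet (T i) := fun i =>
    ((isClopen_valuation_le (h0 (n + 1))).2.preimage (by fun_prop)).measurableSet
  have : Fintype 𝓀[F] := Fintype.ofFinite _
  rw [hunion, measure_iUnion hdisj hmeas, tsum_fintype]
  simp only [T, measure_preimage_add]
  rw [Finset.sum_const, nsmul_eq_mul, residueCard, Nat.card_eq_fintype_card, Finset.card_univ]

lemma residueCard_pos (F : Type*) [Field F] [ValuativeRel F] [TopologicalSpace F]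
    [IsNonarchimedeanLocalField F] : 0 < residueCard F := Nat.card_pos

lemma measureReal_ball [MeasurableSpace F] [BorelSpace F] (ν : Measure F) [ν.IsAddHaarMeasure]
    (hν : ν {x : F | x ∈ 𝒪[F]} = 1) {ϖ : Fˣ} (hϖ : IsUniformizer ϖ) (n : ℤ) :
    ν.real {x : F | valuation F x ≤ valuation F (ϖ : F) ^ n} = (residueCard F : ℝ) ^ (-n) := by
  have hq : (residueCard F : ℝ) ≠ 0 := by exact_mod_cast (residueCard_pos F).ne'
  have hstep : ∀ n : ℤ, ν.real {x : F | valuation F x ≤ valuation F (ϖ : F) ^ n} =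
      residueCard F * ν.real {x : F | valuation F x ≤ valuation F (ϖ : F) ^ (n + 1)} := by
    intro n
    simp [Measure.real, measure_ball_eq_mul ν hϖ n]
  induction n using Int.induction_on with
  | zero =>
    have h1 : ν {x : F | valuation F x ≤ 1} = 1 := hν
    simp [Measure.real, h1]
  | succ n ih =>
    have := hstep n
    rw [ih] at this
    rw [neg_add, zpow_add₀ hq, this]
    field_simp
  | pred n ih =>
    have := hstep (-n - 1)
    rw [sub_add_cancel, ih] at this
    rw [this, neg_sub, sub_eq_add_neg, zpow_add₀ hq, zpow_one]

end LocalField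

/-! ### The Cartan decomposition of `GL₂(F)` -/

section Matrices

variable {F : Type*} [Field F]

lemma coe_inv_apply_fin_two (g : GL (Fin 2) F) (r s : Fin 2) :
    ((g⁻¹ : GL (Fin 2) F) : Matrix (Fin 2) (Fin 2) F) r s =
      (g : Matrix (Fin 2) (Fin 2) F).det⁻¹ * (g : Matrix (Fin 2) (Fin 2) F).adjugate r s := by
  rw [Matrix.coe_units_inv, Matrix.inv_def, Ring.inverse_eq_inv', Matrix.smul_apply, smul_eq_mul]

lemma diagGL_inv (x y : Fˣ) : (diagGL x y)⁻¹ = diagGL x⁻¹ y⁻¹ := Units.ext rfl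

lemma unipotent_zero : unipotent (0 : F) = 1 := by
  ext r s
  fin_cases r <;> fin_cases s <;> simp [unipotent]

/-- The Weyl element exchanging the two coordinates. -/
def weylGL (F : Type*) [Field F] : GL (Fin 2) F where
  val := !![0, 1; 1, 0]
  inv := !![0, 1; 1, 0]
  val_inv := by simp [Matrix.one_fin_two]
  inv_val := by simp [Matrix.one_fin_two]

lemma weylGL_mul_diagGL_mul_weylGL (x y : Fˣ) :
    weylGL F * diagGL x y * weylGL F = diagGL y x := by
  ext r s
  fin_cases r <;> fin_cases s <;> simp [weylGL, diagGL]

lemma continuous_entry [TopologicalSpace F] (r s : Fin 2) :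
    Continuous fun g : GL (Fin 2) F => (g : Matrix (Fin 2) (Fin 2) F) r s :=
  Units.continuous_val.matrix_elem r s

variable [ValuativeRel F]

/-- The set of `g ∈ GL₂(F)` with entries in `ϖ ^ i 𝔬` and `det g ∈ ϖ ^ d 𝔬ˣ`. It is the support
of the convolution `𝟙_{d - 2i} * 𝟙_{i,i}`. -/
def boundedSet (ϖ : Fˣ) (i d : ℤ) : Set (GL (Fin 2) F) :=
  {g | (∀ r s, valuation F ((g : Matrix (Fin 2) (Fin 2) F) r s) ≤ valuation F (ϖ : F) ^ i) ∧
    valuation F (g : Matrix (Fin 2) (Fin 2) F).det = valuation F (ϖ : F) ^ d}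

lemma mem_boundedSet {ϖ : Fˣ} {i d : ℤ} {g : GL (Fin 2) F} : g ∈ boundedSet ϖ i d ↔
    (∀ r s, valuation F ((g : Matrix (Fin 2) (Fin 2) F) r s) ≤ valuation F (ϖ : F) ^ i) ∧
    valuation F (g : Matrix (Fin 2) (Fin 2) F).det = valuation F (ϖ : F) ^ d := Iff.rfl

lemma valuation_adjugate_le {A : Matrix (Fin 2) (Fin 2) F} {γ : ValueGroupWithZero F}
    (h : ∀ r s, valuation F (A r s) ≤ γ) (r s : Fin 2) : valuation F (A.adjugate r s) ≤ γ := by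
  rw [Matrix.adjugate_fin_two]
  fin_cases r <;> fin_cases s <;> simp [h]

lemma valuation_mul_apply_le {A B : Matrix (Fin 2) (Fin 2) F} {γ δ : ValueGroupWithZero F}
    (hA : ∀ r s, valuation F (A r s) ≤ γ) (hB : ∀ r s, valuation F (B r s) ≤ δ) (r s : Fin 2) :
    valuation F ((A * B) r s) ≤ γ * δ := by
  rw [Matrix.mul_apply, Fin.sum_univ_two]
  refine ((valuation F).map_add _ _).trans (max_le ?_ ?_) <;>
  · rw [map_mul]
    exact mul_le_mul' (hA _ _) (hB _ _)

lemma inv_mem_boundedSet {ϖ : Fˣ} {i d : ℤ} {g : GL (Fin 2) F} (hg : g ∈ boundedSet ϖ i d) :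
    g⁻¹ ∈ boundedSet ϖ (i - d) (-d) := by
  have h0 : valuation F (ϖ : F) ≠ 0 := by simp
  refine ⟨fun r s => ?_, ?_⟩
  · rw [coe_inv_apply_fin_two, map_mul, map_inv₀, hg.2, zpow_sub₀ h0, div_eq_inv_mul]
    exact mul_le_mul_right (valuation_adjugate_le hg.1 r s) _
  · rw [Matrix.coe_units_inv, Matrix.det_nonsing_inv, Ring.inverse_eq_inv', map_inv₀, hg.2,
      zpow_neg]

lemma mul_mem_boundedSet {ϖ : Fˣ} {i d i' d' : ℤ} {g h : GL (Fin 2) F}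
    (hg : g ∈ boundedSet ϖ i d) (hh : h ∈ boundedSet ϖ i' d') :
    g * h ∈ boundedSet ϖ (i + i') (d + d') := by
  have h0 : valuation F (ϖ : F) ≠ 0 := by simp
  refine ⟨fun r s => ?_, ?_⟩
  · rw [zpow_add₀ h0]
    exact valuation_mul_apply_le hg.1 hh.1 r s
  · rw [Matrix.GeneralLinearGroup.coe_mul, Matrix.det_mul, map_mul, hg.2, hh.2, zpow_add₀ h0]

lemma mem_maxCompact_iff (ϖ : Fˣ) {g : GL (Fin 2) F} :
    g ∈ maxCompact F ↔ g ∈ boundedSet ϖ 0 0 := by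
  constructor
  · rintro ⟨k, rfl⟩
    refine ⟨fun r s => ?_, ?_⟩
    · rw [zpow_zero]
      exact ((k : Matrix (Fin 2) (Fin 2) 𝒪[F]) r s).2
    · rw [zpow_zero]
      have h := valuation_unit_eq_one (Matrix.GeneralLinearGroup.det k)
      rw [Matrix.GeneralLinearGroup.val_det_apply] at h
      rw [← h]
      exact congrArg (valuation F) (RingHom.map_det (algebraMap 𝒪[F] F) _).symm
  · intro hg
    have hg1 : ∀ r s, valuation F ((g : Matrix (Fin 2) (Fin 2) F) r s) ≤ 1 := by
      simpa using hg.1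
    let A : Matrix (Fin 2) (Fin 2) 𝒪[F] := Matrix.of fun r s => ⟨_, hg1 r s⟩
    have hA : (algebraMap 𝒪[F] F).mapMatrix A = (g : Matrix (Fin 2) (Fin 2) F) := rfl
    have hdet : IsUnit A.det := by
      refine isUnit_integer_of_valuation_eq_one _ ?_
      have h1 : ((A.det : 𝒪[F]) : F) = (g : Matrix (Fin 2) (Fin 2) F).det := by
        rw [← hA, ← RingHom.map_det]
        rfl
      rw [h1, hg.2, zpow_zero]
    refine ⟨Matrix.GeneralLinearGroup.mk'' A hdet, Units.ext ?_⟩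
    exact hA

lemma mul_left_mem_boundedSet {ϖ : Fˣ} {i d : ℤ} {k : GL (Fin 2) F} (hk : k ∈ maxCompact F)
    (g : GL (Fin 2) F) : k * g ∈ boundedSet ϖ i d ↔ g ∈ boundedSet ϖ i d := by
  constructor
  · intro h
    have := mul_mem_boundedSet ((mem_maxCompact_iff ϖ).1 (inv_mem hk)) h
    simpa using this
  · intro h
    have := mul_mem_boundedSet ((mem_maxCompact_iff ϖ).1 hk) h
    simpa using this

lemma mul_right_mem_boundedSet {ϖ : Fˣ} {i d : ℤ} {k : GL (Fin 2) F} (hk : k ∈ maxCompact F)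
    (g : GL (Fin 2) F) : g * k ∈ boundedSet ϖ i d ↔ g ∈ boundedSet ϖ i d := by
  constructor
  · intro h
    have := mul_mem_boundedSet h ((mem_maxCompact_iff ϖ).1 (inv_mem hk))
    simpa using this
  · intro h
    have := mul_mem_boundedSet h ((mem_maxCompact_iff ϖ).1 hk)
    simpa using this

lemma diagGL_mul_unipotent_mem_boundedSet {ϖ : Fˣ} (hϖ : IsUniformizer ϖ) {i d a b : ℤ} {x : F} :
    diagGL (ϖ ^ a) (ϖ ^ b) * unipotent x ∈ boundedSet ϖ i d ↔
      (i ≤ a ∧ i ≤ b ∧ a + b = d) ∧ valuation F x ≤ valuation F (ϖ : F) ^ (i - a) := by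
  have h0 : valuation F (ϖ : F) ≠ 0 := by simp
  have hval : ((diagGL (ϖ ^ a) (ϖ ^ b) * unipotent x : GL (Fin 2) F) :
      Matrix (Fin 2) (Fin 2) F) = !![(ϖ : F) ^ a, (ϖ : F) ^ a * x; 0, (ϖ : F) ^ b] := by
    simp [diagGL, unipotent]
  have hmul : valuation F (ϖ : F) ^ a * valuation F x ≤ valuation F (ϖ : F) ^ i ↔
      valuation F x ≤ valuation F (ϖ : F) ^ (i - a) := by
    rw [zpow_sub₀ h0, le_div_iff₀ (zero_lt_iff.2 (zpow_ne_zero _ h0)), mul_comm]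
  rw [mem_boundedSet, hval, Matrix.det_fin_two]
  simp only [Fin.forall_fin_two, Matrix.of_apply, Matrix.cons_val', Matrix.cons_val_zero,
    Matrix.cons_val_one, Matrix.cons_val_fin_one, map_zpow₀, map_mul, map_zero, mul_zero, sub_zero,
    hmul, valuation_zpow_le_iff hϖ, zero_le, ← zpow_add₀ h0, valuation_zpow_inj hϖ]
  tauto

lemma diagGL_mem_boundedSet {ϖ : Fˣ} (hϖ : IsUniformizer ϖ) {i d a b : ℤ} :
    diagGL (ϖ ^ a) (ϖ ^ b) ∈ boundedSet ϖ i d ↔ i ≤ a ∧ i ≤ b ∧ a + b = d := by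
  have := diagGL_mul_unipotent_mem_boundedSet hϖ (i := i) (d := d) (a := a) (b := b) (x := 0)
  rw [unipotent_zero, mul_one] at this
  simpa using this

lemma weylGL_mem : weylGL F ∈ maxCompact F := by
  rw [mem_maxCompact_iff 1]
  refine ⟨fun r s => ?_, ?_⟩
  · fin_cases r <;> fin_cases s <;> simp [weylGL]
  · simp [weylGL, Matrix.det_fin_two]

lemma unipotent_mem {x : F} (hx : valuation F x ≤ 1) : unipotent x ∈ maxCompact F := by
  rw [mem_maxCompact_iff 1]
  refine ⟨fun r s => ?_, ?_⟩
  · fin_cases r <;> fin_cases s <;> simp [unipotent, hx]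
  · simp [unipotent, Matrix.det_fin_two]

lemma diagGL_mem {x y : Fˣ} (hx : valuation F (x : F) = 1) (hy : valuation F (y : F) = 1) :
    diagGL x y ∈ maxCompact F := by
  rw [mem_maxCompact_iff 1]
  refine ⟨fun r s => ?_, ?_⟩
  · fin_cases r <;> fin_cases s <;> simp [diagGL, hx, hy]
  · simp [diagGL, Matrix.det_fin_two, hx, hy]

variable [TopologicalSpace F] [IsNonarchimedeanLocalField F]

/-- A matrix whose upper left entry has the largest absolute value is reduced to a diagonal matrix
by clearing the first row and column. -/
lemma exists_cartan_of_pivot {ϖ : Fˣ} (hϖ : IsUniformizer ϖ) (g : GL (Fin 2) F)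
    (hg : ∀ r s, valuation F ((g : Matrix (Fin 2) (Fin 2) F) r s) ≤
      valuation F ((g : Matrix (Fin 2) (Fin 2) F) 0 0)) :
    ∃ k₁ ∈ maxCompact F, ∃ k₂ ∈ maxCompact F, ∃ a b : ℤ,
      g = k₁ * diagGL (ϖ ^ a) (ϖ ^ b) * k₂ := by
  set A : Matrix (Fin 2) (Fin 2) F := (g : Matrix (Fin 2) (Fin 2) F) with hA
  have hdet : A.det ≠ 0 := Matrix.GeneralLinearGroup.det_ne_zero g
  have hp : A 0 0 ≠ 0 := by
    intro h
    refine hdet ?_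
    have h1 : ∀ r s, A r s = 0 := fun r s => by simpa [h] using hg r s
    simp [Matrix.det_fin_two, h1]
  have hd : A.det / A 0 0 ≠ 0 := div_ne_zero hdet hp
  obtain ⟨a, ha⟩ := exists_valuation_eq_zpow hϖ hp
  obtain ⟨b, hb⟩ := exists_valuation_eq_zpow hϖ hd
  have h0 : ∀ n : ℤ, valuation F (ϖ : F) ^ n ≠ 0 := fun n => zpow_ne_zero _ (by simp)
  have hx : ∀ r s, valuation F (A r s / A 0 0) ≤ 1 := fun r s => by
    rw [map_div₀]
    exact div_le_one_of_le₀ (hg r s) zero_le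
  have hxu : valuation F ((Units.mk0 _ hp * (ϖ ^ a)⁻¹ : Fˣ) : F) = 1 := by
    simp [ha, h0 a]
  have hyu : valuation F ((Units.mk0 _ hd * (ϖ ^ b)⁻¹ : Fˣ) : F) = 1 := by
    rw [Units.val_mul, Units.val_mk0, map_mul, hb]
    simp [h0 b]
  refine ⟨weylGL F * unipotent (A 1 0 / A 0 0) * weylGL F *
      diagGL (Units.mk0 _ hp * (ϖ ^ a)⁻¹) (Units.mk0 _ hd * (ϖ ^ b)⁻¹),
    mul_mem (mul_mem (mul_mem weylGL_mem (unipotent_mem (hx _ _))) weylGL_mem)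
      (diagGL_mem hxu hyu),
    unipotent (A 0 1 / A 0 0), unipotent_mem (hx _ _), a, b, ?_⟩
  have hϖ0 : (ϖ : F) ≠ 0 := ϖ.ne_zero
  refine Units.ext ?_
  change A = _
  ext r s
  fin_cases r <;> fin_cases s <;>
    simp [weylGL, diagGL, unipotent, Matrix.det_fin_two]
  all_goals field_simp
  all_goals ring

/-- The Cartan decomposition `GL₂(F) = ⋃ K diag(ϖ ^ a, ϖ ^ b) K`. -/
lemma exists_cartan {ϖ : Fˣ} (hϖ : IsUniformizer ϖ) (g : GL (Fin 2) F) :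
    ∃ k₁ ∈ maxCompact F, ∃ k₂ ∈ maxCompact F, ∃ a b : ℤ,
      g = k₁ * diagGL (ϖ ^ a) (ϖ ^ b) * k₂ := by
  -- `σ 0 = 1` and `σ 1` is the Weyl element: they move the largest entry to the corner.
  let σ : Fin 2 → GL (Fin 2) F := ![1, weylGL F]
  have hσ : ∀ r, σ r ∈ maxCompact F := by
    intro r
    fin_cases r
    · exact one_mem _
    · exact weylGL_mem
  have hσσ : ∀ r, σ r * σ r = 1 := by
    intro r
    fin_cases r
    · exact one_mul _
    · exact Units.ext (weylGL F).val_inv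
  obtain ⟨p, hp⟩ := Finite.exists_max (fun p : Fin 2 × Fin 2 =>
    valuation F ((g : Matrix (Fin 2) (Fin 2) F) p.1 p.2))
  obtain ⟨k₁, h₁, k₂, h₂, a, b, h⟩ := exists_cartan_of_pivot hϖ (σ p.1 * g * σ p.2) (by
    obtain ⟨r₀, s₀⟩ := p
    intro r s
    have e1 : ∃ r' s', ((σ r₀ * g * σ s₀ : GL (Fin 2) F) : Matrix (Fin 2) (Fin 2) F) r s =
        (g : Matrix (Fin 2) (Fin 2) F) r' s' := by
      fin_cases r₀ <;> fin_cases s₀ <;> fin_cases r <;> fin_cases s <;>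
        simp [σ, weylGL, Matrix.mul_apply, Matrix.vecMul, dotProduct, Fin.exists_fin_two]
    have e2 : ((σ r₀ * g * σ s₀ : GL (Fin 2) F) : Matrix (Fin 2) (Fin 2) F) 0 0 =
        (g : Matrix (Fin 2) (Fin 2) F) r₀ s₀ := by
      fin_cases r₀ <;> fin_cases s₀ <;>
        simp [σ, weylGL, Matrix.mul_apply, Matrix.vecMul, dotProduct]
    obtain ⟨r', s', e1⟩ := e1
    rw [e1, e2]
    exact hp (r', s'))
  refine ⟨σ p.1 * k₁, mul_mem (hσ _) h₁, k₂ * σ p.2, mul_mem h₂ (hσ _), a, b, ?_⟩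
  calc g = (σ p.1 * σ p.1) * g * (σ p.2 * σ p.2) := by rw [hσσ, hσσ, one_mul, mul_one]
    _ = σ p.1 * (σ p.1 * g * σ p.2) * σ p.2 := by group
    _ = _ := by rw [h]; group

/-- A `K`-bi-invariant function is determined by its values on the diagonal matrices. -/
lemma eq_of_eq_on_diagGL {ϖ : Fˣ} (hϖ : IsUniformizer ϖ) {f f' : GL (Fin 2) F → ℂ}
    (hf : ∀ k₁ ∈ maxCompact F, ∀ k₂ ∈ maxCompact F, ∀ g, f (k₁ * g * k₂) = f g)
    (hf' : ∀ k₁ ∈ maxCompact F, ∀ k₂ ∈ maxCompact F, ∀ g, f' (k₁ * g * k₂) = f' g)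
    (h : ∀ a b : ℤ, f (diagGL (ϖ ^ a) (ϖ ^ b)) = f' (diagGL (ϖ ^ a) (ϖ ^ b))) : f = f' := by
  funext g
  obtain ⟨k₁, h₁, k₂, h₂, a, b, rfl⟩ := exists_cartan hϖ g
  rw [hf _ h₁ _ h₂, hf' _ h₁ _ h₂, h]

/-! ### Topology of the sets of bounded matrices -/

lemma isClopen_valuation_det_eq {ϖ : Fˣ} (hϖ : IsUniformizer ϖ) (d : ℤ) :
    IsClopen {g : GL (Fin 2) F |
      valuation F (g : Matrix (Fin 2) (Fin 2) F).det = valuation F (ϖ : F) ^ d} :=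
  (isClopen_valuation_eq hϖ d).preimage Units.continuous_val.matrix_det

lemma isClopen_boundedSet {ϖ : Fˣ} (hϖ : IsUniformizer ϖ) (i d : ℤ) :
    IsClopen (boundedSet ϖ i d : Set (GL (Fin 2) F)) := by
  have h0 : valuation F (ϖ : F) ^ i ≠ 0 := zpow_ne_zero _ (by simp)
  have : (boundedSet ϖ i d : Set (GL (Fin 2) F)) =
      (⋂ r, ⋂ s, {g : GL (Fin 2) F |
        valuation F ((g : Matrix (Fin 2) (Fin 2) F) r s) ≤ valuation F (ϖ : F) ^ i}) ∩
      {g : GL (Fin 2) F |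
        valuation F (g : Matrix (Fin 2) (Fin 2) F).det = valuation F (ϖ : F) ^ d} := by
    ext g
    simp [boundedSet]
  rw [this]
  exact (isClopen_iInter_of_finite fun r => isClopen_iInter_of_finite fun s =>
    (isClopen_valuation_le h0).preimage (continuous_entry r s)).inter
      (isClopen_valuation_det_eq hϖ d)

/-- Both `g` and `g⁻¹` are bounded on `boundedSet ϖ i d`, and `GL₂(F)` is closed in the space of
pairs of matrices. -/
lemma isCompact_boundedSet {ϖ : Fˣ} (hϖ : IsUniformizer ϖ) (i d : ℤ) :
    IsCompact (boundedSet ϖ i d : Set (GL (Fin 2) F)) := by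
  let C : ℤ → Set (Matrix (Fin 2) (Fin 2) F) := fun j =>
    Set.univ.pi fun _ => Set.univ.pi fun _ => {x | valuation F x ≤ valuation F (ϖ : F) ^ j}
  have hC : ∀ j, IsCompact (C j) := fun j => isCompact_univ_pi fun _ => isCompact_univ_pi fun _ =>
    IsNonarchimedeanLocalField.isCompact_closedBall F _
  have hmem : ∀ j A, A ∈ C j ↔ ∀ r s, valuation F (A r s) ≤ valuation F (ϖ : F) ^ j := by
    intro j A
    exact ⟨fun h r s => h r trivial s trivial, fun h r _ s _ => h r s⟩
  have hcomp : IsCompact ((Units.embedProduct (Matrix (Fin 2) (Fin 2) F)) ⁻¹'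
      (C i ×ˢ (MulOpposite.unop ⁻¹' C (i - d)))) :=
    Units.isClosedEmbedding_embedProduct.isCompact_preimage
      ((hC i).prod (MulOpposite.opHomeomorph.symm.isCompact_preimage.2 (hC (i - d))))
  refine hcomp.of_isClosed_subset (isClopen_boundedSet hϖ i d).1 fun g hg => ?_
  exact ⟨(hmem _ _).2 hg.1, (hmem _ _).2 (inv_mem_boundedSet hg).1⟩

end Matrices

/-! ### Symmetric Laurent coefficients in the basis `h_m(t₁, t₂) (t₁ t₂) ^ i` -/

/-- The coefficient of `t₁ ^ p.1 t₂ ^ p.2` in `h_m(t₁, t₂) (t₁ t₂) ^ i`, where `k = (m, i)`. -/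
def schurCoeff (k : ℕ × ℤ) (p : ℤ × ℤ) : ℂ :=
  if k.2 ≤ p.1 ∧ k.2 ≤ p.2 ∧ p.1 + p.2 = k.1 + 2 * k.2 then 1 else 0

/-- The coefficients of `∑ c(m, i) w(m, i) h_m(t₁, t₂) (t₁ t₂) ^ i`. -/
def schurSum (w : ℕ × ℤ → ℂ) : (ℕ × ℤ →₀ ℂ) →ₗ[ℂ] (ℤ × ℤ → ℂ) :=
  Finsupp.linearCombination ℂ fun k => w k • schurCoeff k

lemma schurSum_apply (w : ℕ × ℤ → ℂ) (c : ℕ × ℤ →₀ ℂ) (p : ℤ × ℤ) :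
    schurSum w c p = ∑ k ∈ c.support, c k * (w k * schurCoeff k p) := by
  simp [schurSum, Finsupp.linearCombination_apply, Finsupp.sum, Finset.sum_apply]

/-- Multiplication by `t₁ - t₂` turns `h_m(t₁, t₂) (t₁ t₂) ^ i` into an antisymmetrized monomial;
hence the coefficients in this basis are differences of adjacent Laurent coefficients. -/
lemma schurSum_sub (w : ℕ × ℤ → ℂ) (c : ℕ × ℤ →₀ ℂ) (m : ℕ) (i : ℤ) :
    schurSum w c (m + i, i) - schurSum w c (m + i + 1, i - 1) = w (m, i) * c (m, i) := by
  have hdiff : ∀ k : ℕ × ℤ, schurCoeff k (m + i, i) - schurCoeff k (m + i + 1, i - 1) =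
      if k = (m, i) then 1 else 0 := by
    rintro ⟨m', i'⟩
    simp only [schurCoeff, Prod.mk.injEq]
    split_ifs <;> first | (exfalso; omega) | simp
  rw [schurSum_apply, schurSum_apply, ← Finset.sum_sub_distrib]
  simp_rw [← mul_sub, hdiff]
  rw [Finset.sum_eq_single (m, i)]
  · simp [mul_comm]
  · intro k _ hk
    simp [hk]
  · intro h
    simp [Finsupp.notMem_support_iff.1 h]

lemma schurSum_symm (w : ℕ × ℤ → ℂ) (c : ℕ × ℤ →₀ ℂ) (a b : ℤ) :
    schurSum w c (a, b) = schurSum w c (b, a) := by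
  rw [schurSum_apply, schurSum_apply]
  refine Finset.sum_congr rfl fun k _ => ?_
  have : schurCoeff k (a, b) = schurCoeff k (b, a) := by
    simp only [schurCoeff]
    exact if_congr (by rw [add_comm a b]; tauto) rfl rfl
  rw [this]

lemma schurSum_support_finite (w : ℕ × ℤ → ℂ) (c : ℕ × ℤ →₀ ℂ) :
    (Function.support (schurSum w c)).Finite := by
  refine (c.support.finite_toSet.biUnion (t := fun k : ℕ × ℤ =>
    (Set.Icc k.2 (k.1 + k.2)) ×ˢ (Set.Icc k.2 (k.1 + k.2)))
    fun k _ => (Set.finite_Icc _ _).prod (Set.finite_Icc _ _)).subset ?_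
  rintro ⟨a, b⟩ hp
  rw [Function.mem_support, schurSum_apply] at hp
  obtain ⟨k, hk, hne⟩ := Finset.exists_ne_zero_of_sum_ne_zero hp
  refine Set.mem_biUnion (Finset.mem_coe.2 hk) ?_
  have h1 : schurCoeff k (a, b) ≠ 0 := fun h => hne (by simp [h])
  simp only [schurCoeff, ne_eq, ite_eq_right_iff, one_ne_zero, imp_false, not_not] at h1
  simp only [Set.mem_prod, Set.mem_Icc]
  omega

/-- A symmetric finitely supported function whose adjacent differences vanish is constant along
the rays `(a + n, b - n)`, so it is zero. -/
lemma eq_zero_of_adjacent_eq {D : ℤ × ℤ → ℂ} (hsymm : ∀ a b, D (a, b) = D (b, a))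
    (hfin : (Function.support D).Finite)
    (hD : ∀ (m : ℕ) (i : ℤ), D (m + i, i) = D (m + i + 1, i - 1)) : D = 0 := by
  have key : ∀ a b : ℤ, b ≤ a → D (a, b) = 0 := by
    intro a b hab
    have hray : ∀ n : ℕ, D (a + n, b - n) = D (a, b) := by
      intro n
      induction n with
      | zero => simp
      | succ n ih =>
        rw [← ih]
        have := hD (a - b + 2 * n).toNat (b - n)
        rw [Int.toNat_of_nonneg (by omega)] at this
        convert this.symm using 3 <;> push_cast <;> ring
    by_contra hne
    refine Set.infinite_of_injective_forall_mem (f := fun n : ℕ => (a + (n : ℤ), b - (n : ℤ)))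
      (fun n n' h => ?_) (fun n => ?_) hfin
    · have := congrArg Prod.fst h
      simpa using this
    · rw [Function.mem_support, hray]
      exact hne
  funext ⟨a, b⟩
  rcases le_total b a with h | h
  · exact key a b h
  · rw [hsymm]
    exact key b a h

lemma eq_schurSum {w : ℕ × ℤ → ℂ} {P : ℤ × ℤ → ℂ} (hsymm : ∀ a b, P (a, b) = P (b, a))
    (hfin : (Function.support P).Finite) {c : ℕ × ℤ →₀ ℂ}
    (hP : ∀ (m : ℕ) (i : ℤ), P (m + i, i) - P (m + i + 1, i - 1) = w (m, i) * c (m, i)) :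
    P = schurSum w c := by
  rw [← sub_eq_zero]
  refine eq_zero_of_adjacent_eq (fun a b => ?_) ?_ fun m i => ?_
  · rw [Pi.sub_apply, Pi.sub_apply, hsymm, schurSum_symm]
  · exact (hfin.union (schurSum_support_finite w c)).subset (Function.support_sub _ _)
  · rw [Pi.sub_apply, Pi.sub_apply, sub_eq_sub_iff_sub_eq_sub, hP, schurSum_sub]

lemma exists_eq_schurSum {w : ℕ × ℤ → ℂ} (hw : ∀ k, w k ≠ 0) {P : ℤ × ℤ → ℂ}
    (hsymm : ∀ a b, P (a, b) = P (b, a)) (hfin : (Function.support P).Finite) :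
    ∃ c, P = schurSum w c := by
  let c : ℕ × ℤ → ℂ := fun k => (w k)⁻¹ * (P (k.1 + k.2, k.2) - P (k.1 + k.2 + 1, k.2 - 1))
  have hc : (Function.support c).Finite := by
    have h1 : (((fun k : ℕ × ℤ => ((k.1 : ℤ) + k.2, k.2)) ⁻¹' Function.support P) ∪
        ((fun k : ℕ × ℤ => ((k.1 : ℤ) + k.2 + 1, k.2 - 1)) ⁻¹' Function.support P)).Finite := by
      refine (hfin.preimage ?_).union (hfin.preimage ?_) <;>
      · rintro ⟨m, i⟩ - ⟨m', i'⟩ - h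
        simp only [Prod.mk.injEq] at h ⊢
        omega
    refine h1.subset fun k hk => ?_
    by_contra hn
    simp only [Set.mem_union, Set.mem_preimage, Function.mem_support, not_or, not_not] at hn
    exact hk (by simp [c, hn.1, hn.2])
  refine ⟨Finsupp.ofSupportFinite c hc, eq_schurSum hsymm hfin fun m i => ?_⟩
  rw [Finsupp.ofSupportFinite_coe]
  simp only [c]
  rw [mul_inv_cancel_left₀ (hw _)]

lemma schurSum_injective {w : ℕ × ℤ → ℂ} (hw : ∀ k, w k ≠ 0) :
    Function.Injective (schurSum w) := by
  intro c c' h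
  ext ⟨m, i⟩
  refine mul_left_cancel₀ (hw (m, i)) ?_
  rw [← schurSum_sub, ← schurSum_sub, h]

/-! ### The decomposition of `Sym^j(Sym^3)` -/

/-- The triples `(b, c, d)` for which the monomial `λ₀ ^ (j - b - c - d) λ₁ ^ b λ₂ ^ c λ₃ ^ d` of
degree `j` in the eigenvalues `λᵢ = t₁ ^ (3 - i) t₂ ^ i` has degree `y` in `t₂`. -/
def boxTriples (j : ℕ) (y : ℤ) : Set (ℕ × ℕ × ℕ) :=
  {t | t.1 + t.2.1 + t.2.2 ≤ j ∧ (t.1 : ℤ) + 2 * t.2.1 + 3 * t.2.2 = y}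

lemma boxTriples_finite (j : ℕ) (y : ℤ) : (boxTriples j y).Finite := by
  refine ((Set.finite_Iic j).prod ((Set.finite_Iic j).prod (Set.finite_Iic j))).subset ?_
  rintro ⟨b, c, d⟩ ⟨h, -⟩
  simp only [Set.mem_prod, Set.mem_Iic] at h ⊢
  omega

lemma prod_symEigenvalue (k : ℕ) (s : Multiset (Fin (k + 1))) :
    (s.map (symEigenvalue k)).prod =
      AddMonoidAlgebra.single
        (s.map fun i : Fin (k + 1) => ((k : ℤ) - (i : ℤ), (i : ℤ))).sum 1 := by
  induction s using Multiset.induction_on with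
  | empty => simp [AddMonoidAlgebra.one_def]
  | cons a s ih =>
    rw [Multiset.map_cons, Multiset.prod_cons, ih, symEigenvalue, tMonomial,
      AddMonoidAlgebra.single_mul_single, Multiset.map_cons, Multiset.sum_cons, one_mul]

lemma symSym_coeff (j k : ℕ) (p : ℤ × ℤ) :
    (symSym j k).coeff p = ({s : Sym (Fin (k + 1)) j |
      ((s : Multiset (Fin (k + 1))).map
        fun i : Fin (k + 1) => ((k : ℤ) - (i : ℤ), (i : ℤ))).sum = p}.ncard : ℂ) := by
  classical
  have h1 : symSym j k = ∑ s : Sym (Fin (k + 1)) j, AddMonoidAlgebra.single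
      ((s : Multiset (Fin (k + 1))).map
        fun i : Fin (k + 1) => ((k : ℤ) - (i : ℤ), (i : ℤ))).sum (1 : ℂ) := by
    rw [symSym, MvPolynomial.hsymm, map_sum]
    refine Finset.sum_congr rfl fun s _ => ?_
    rw [map_multiset_prod, Multiset.map_map, ← prod_symEigenvalue]
    congr 2
    funext i
    simp
  rw [h1, AddMonoidAlgebra.coeff_sum, Finsupp.finsetSum_apply]
  simp only [AddMonoidAlgebra.coeff_single, Finsupp.single_apply]
  rw [Finset.sum_boole, Set.ncard_eq_toFinset_card', Set.toFinset_ofPred]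

lemma sum_weight_three (s : Multiset (Fin 4)) :
    (s.map fun i : Fin 4 => (((3 : ℕ) : ℤ) - (i : ℤ), (i : ℤ))).sum =
      (3 * (s.count 0 : ℤ) + 2 * s.count 1 + s.count 2,
        (s.count 1 : ℤ) + 2 * s.count 2 + 3 * s.count 3) := by
  induction s using Multiset.induction_on with
  | empty => rfl
  | cons a s ih =>
    rw [Multiset.map_cons, Multiset.sum_cons, ih]
    simp only [Multiset.count_cons]
    fin_cases a <;> ext <;> simp <;> ring

lemma sum_count_fin_four {j : ℕ} (s : Sym (Fin 4) j) :
    (s : Multiset (Fin 4)).count 0 + (s : Multiset (Fin 4)).count 1 +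
      (s : Multiset (Fin 4)).count 2 + (s : Multiset (Fin 4)).count 3 = j := by
  have h := Multiset.sum_count_eq_card (s := Finset.univ) (m := (s : Multiset (Fin 4))) (by simp)
  rwa [Fin.sum_univ_four, Sym.card_coe] at h

lemma symSym_three_coeff (j : ℕ) (x y : ℤ) :
    (symSym j 3).coeff (x, y) = if x + y = 3 * j then ((boxTriples j y).ncard : ℂ) else 0 := by
  have hset : {s : Sym (Fin (3 + 1)) j | ((s : Multiset (Fin (3 + 1))).map
      fun i : Fin (3 + 1) => (((3 : ℕ) : ℤ) - (i : ℤ), (i : ℤ))).sum = (x, y)} =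
      {s : Sym (Fin 4) j | (3 * ((s : Multiset (Fin 4)).count 0 : ℤ) +
        2 * (s : Multiset (Fin 4)).count 1 + (s : Multiset (Fin 4)).count 2,
        ((s : Multiset (Fin 4)).count 1 : ℤ) + 2 * (s : Multiset (Fin 4)).count 2 +
          3 * (s : Multiset (Fin 4)).count 3) = (x, y)} :=
    Set.ext fun s => (congrArg (· = (x, y)) (sum_weight_three s)).to_iff
  rw [symSym_coeff, hset]
  split_ifs with hxy
  · congr 1
    refine Set.ncard_congr (fun s _ => ((s : Multiset (Fin 4)).count 1,
      (s : Multiset (Fin 4)).count 2, (s : Multiset (Fin 4)).count 3)) ?_ ?_ ?_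
    · intro s hs
      have h1 := sum_count_fin_four s
      have h2 := congrArg Prod.snd (show _ = _ from hs)
      exact ⟨by simp only; omega, h2⟩
    · intro s s' _ _ h
      have h1 := sum_count_fin_four s
      have h2 := sum_count_fin_four s'
      simp only [Prod.mk.injEq] at h
      refine Sym.ext (Multiset.ext.2 fun i => ?_)
      fin_cases i <;> simp only [Fin.zero_eta, Fin.mk_one, Fin.reduceFinMk] <;> omega
    · rintro ⟨b, c, d⟩ ⟨h1, h2⟩
      simp only at h1 h2
      let P : {P : Fin 4 → ℕ // ∑ i, P i = j} :=
        ⟨![j - b - c - d, b, c, d], by simp [Fin.sum_univ_four]; omega⟩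
      have hcount : ∀ i, ((((Sym.equivNatSumOfFintype (Fin 4) j).symm P : Sym (Fin 4) j)) :
          Multiset (Fin 4)).count i = P.1 i := by
        intro i
        rw [← Sym.coe_equivNatSumOfFintype_apply_apply, Equiv.apply_symm_apply]
      refine ⟨(Sym.equivNatSumOfFintype (Fin 4) j).symm P, ?_, ?_⟩
      · simp only [Set.mem_ofPred_eq, hcount, P, Prod.mk.injEq]
        simp
        omega
      · simp only [hcount, P]
        simp
  · rw [Nat.cast_eq_zero]
    refine (congrArg Set.ncard (Set.eq_empty_iff_forall_notMem.2 fun s => ?_)).trans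
      (Set.ncard_empty _)
    have h1 := sum_count_fin_four s
    simp only [Set.mem_ofPred_eq, Prod.mk.injEq]
    omega

/-- The symmetry is the reversal of the four eigenvalues. -/
lemma ncard_boxTriples_reflect (j : ℕ) (y : ℤ) :
    (boxTriples j y).ncard = (boxTriples j (3 * j - y)).ncard := by
  refine Set.ncard_congr (fun t _ => (t.2.1, t.1, j - t.1 - t.2.1 - t.2.2)) ?_ ?_ ?_
  · rintro ⟨b, c, d⟩ ⟨h1, h2⟩
    simp only [boxTriples, Set.mem_ofPred_eq] at *
    omega
  · rintro ⟨b, c, d⟩ ⟨b', c', d'⟩ ⟨h1, -⟩ ⟨h1', -⟩ h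
    simp only [Prod.mk.injEq] at *
    omega
  · rintro ⟨b, c, d⟩ ⟨h1, h2⟩
    refine ⟨(c, b, j - b - c - d), ?_, ?_⟩
    · simp only [boxTriples, Set.mem_ofPred_eq] at *
      omega
    · simp only [Prod.mk.injEq, true_and] at h1 ⊢
      omega

lemma ncard_two_three (y : ℕ) : {t : ℕ × ℕ | 2 * t.1 + 3 * t.2 = y}.ncard =
    (Finset.Icc ((y + 2) / 3) (y / 2)).card := by
  rw [← Set.ncard_coe_finset]
  -- `e = c + d` determines the solution: `c = 3 e - y` and `d = y - 2 e`.
  refine Set.ncard_congr (fun t _ => t.1 + t.2) ?_ ?_ ?_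
  · rintro ⟨c, d⟩ h
    simp only [Set.mem_ofPred_eq, Finset.coe_Icc, Set.mem_Icc] at *
    omega
  · rintro ⟨c, d⟩ ⟨c', d'⟩ h h' he
    simp only [Set.mem_ofPred_eq, Prod.mk.injEq] at *
    omega
  · intro e he
    simp only [Finset.coe_Icc, Set.mem_Icc] at he
    refine ⟨(3 * e - y, y - 2 * e), ?_, ?_⟩
    · simp only [Set.mem_ofPred_eq]
      omega
    · simp only
      omega

lemma ncard_one_two (y : ℕ) : {t : ℕ × ℕ | t.1 + 2 * t.2 = y}.ncard = y / 2 + 1 := by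
  rw [← Finset.card_range (y / 2 + 1), ← Set.ncard_coe_finset]
  refine Set.ncard_congr (fun t _ => t.2) ?_ ?_ ?_
  · rintro ⟨c, d⟩ h
    simp only [Set.mem_ofPred_eq, Finset.coe_range, Set.mem_Iio] at *
    omega
  · rintro ⟨c, d⟩ ⟨c', d'⟩ h h' he
    simp only [Set.mem_ofPred_eq, Prod.mk.injEq] at *
    omega
  · intro d hd
    simp only [Finset.coe_range, Set.mem_Iio] at hd
    refine ⟨(y - 2 * d, d), ?_, rfl⟩
    simp only [Set.mem_ofPred_eq]
    omega

/-- Raising the first coordinate by one identifies `boxTriples j (y - 1)` with the triples of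
weight `y` with positive first coordinate and sum at most `j + 1`. Up to the middle weight, the two
sets compared by this shift differ by solution sets of unconstrained linear equations. -/
lemma ncard_boxTriples_sub (j n : ℕ) (hn : 2 * n ≤ 3 * j) :
    ((boxTriples j n).ncard : ℤ) - (boxTriples j ((n : ℤ) - 1)).ncard =
      {t : ℕ × ℕ | 2 * t.1 + 3 * t.2 = n}.ncard -
        if j + 1 ≤ n then ({t : ℕ × ℕ | t.1 + 2 * t.2 = n - j - 1}.ncard : ℤ) else 0 := by
  -- `boxTriples j n` is the union of `Z` and `Y`; the shift maps `boxTriples j (n - 1)` onto the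
  -- union of `Y` and `W`.
  let Z : Set (ℕ × ℕ × ℕ) := boxTriples j n ∩ {t | t.1 = 0}
  let W : Set (ℕ × ℕ × ℕ) := {t | 1 ≤ t.1 ∧ t.1 + t.2.1 + t.2.2 = j + 1 ∧
    t.1 + 2 * t.2.1 + 3 * t.2.2 = n}
  let Y : Set (ℕ × ℕ × ℕ) := boxTriples j n ∩ {t | 1 ≤ t.1}
  have hYfin : Y.Finite := (boxTriples_finite j n).inter_of_left _
  have hZfin : Z.Finite := (boxTriples_finite j n).inter_of_left _
  have hWfin : W.Finite := by
    refine (boxTriples_finite (j + 1) n).subset ?_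
    rintro ⟨b, c, d⟩ h
    simp only [W, boxTriples, Set.mem_ofPred_eq] at *
    omega
  have h1 : (boxTriples j n).ncard = Z.ncard + Y.ncard := by
    rw [← Set.ncard_union_eq _ hZfin hYfin]
    · congr 1
      ext ⟨b, c, d⟩
      simp only [Z, Y, Set.mem_union, Set.mem_inter_iff, Set.mem_ofPred_eq]
      have : b = 0 ∨ 1 ≤ b := by omega
      tauto
    · refine Set.disjoint_left.2 ?_
      rintro ⟨b, c, d⟩ h h'
      simp only [Z, Y, Set.mem_inter_iff, Set.mem_ofPred_eq] at *
      omega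
  have h2 : (boxTriples j ((n : ℤ) - 1)).ncard = Y.ncard + W.ncard := by
    rw [← Set.ncard_union_eq _ hYfin hWfin]
    · refine Set.ncard_congr (fun t _ => (t.1 + 1, t.2)) ?_ ?_ ?_
      · rintro ⟨b, c, d⟩ h
        simp only [Y, W, boxTriples, Set.mem_union, Set.mem_inter_iff, Set.mem_ofPred_eq] at *
        omega
      · rintro ⟨b, c, d⟩ ⟨b', c', d'⟩ - - h
        simp only [Prod.mk.injEq] at *
        omega
      · rintro ⟨b, c, d⟩ h
        refine ⟨(b - 1, c, d), ?_, ?_⟩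
        · simp only [Y, W, boxTriples, Set.mem_union, Set.mem_inter_iff, Set.mem_ofPred_eq] at *
          omega
        · simp only [Y, W, boxTriples, Set.mem_union, Set.mem_inter_iff, Set.mem_ofPred_eq,
            Prod.mk.injEq, and_true] at *
          omega
    · refine Set.disjoint_left.2 ?_
      rintro ⟨b, c, d⟩ h h'
      simp only [Y, W, boxTriples, Set.mem_inter_iff, Set.mem_ofPred_eq] at *
      omega
  have h3 : Z.ncard = {t : ℕ × ℕ | 2 * t.1 + 3 * t.2 = n}.ncard := by
    refine Set.ncard_congr (fun t _ => t.2) ?_ ?_ ?_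
    · rintro ⟨b, c, d⟩ h
      simp only [Z, boxTriples, Set.mem_inter_iff, Set.mem_ofPred_eq] at *
      omega
    · rintro ⟨b, c, d⟩ ⟨b', c', d'⟩ h h' he
      simp only [Z, boxTriples, Set.mem_inter_iff, Set.mem_ofPred_eq, Prod.mk.injEq] at *
      omega
    · rintro ⟨c, d⟩ h
      refine ⟨(0, c, d), ?_, rfl⟩
      simp only [Z, boxTriples, Set.mem_inter_iff, Set.mem_ofPred_eq, and_true] at *
      omega
  have h4 : (W.ncard : ℤ) =
      if j + 1 ≤ n then ({t : ℕ × ℕ | t.1 + 2 * t.2 = n - j - 1}.ncard : ℤ) else 0 := by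
    split_ifs with hj
    · congr 1
      refine Set.ncard_congr (fun t _ => t.2) ?_ ?_ ?_
      · rintro ⟨b, c, d⟩ h
        simp only [W, Set.mem_ofPred_eq] at *
        omega
      · rintro ⟨b, c, d⟩ ⟨b', c', d'⟩ h h' he
        simp only [W, Set.mem_ofPred_eq, Prod.mk.injEq] at *
        omega
      · rintro ⟨c, d⟩ h
        refine ⟨(j + 1 - c - d, c, d), ?_, rfl⟩
        simp only [W, Set.mem_ofPred_eq] at *
        omega
    · rw [Nat.cast_eq_zero]
      refine (congrArg Set.ncard (Set.eq_empty_iff_forall_notMem.2 ?_)).trans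
        (Set.ncard_empty _)
      rintro ⟨b, c, d⟩
      simp only [W, Set.mem_ofPred_eq]
      omega
  rw [h1, h2, ← h3, ← h4]
  push_cast
  ring

/-- The coefficient `⌊n/2⌋ - ⌊(n-1)/3⌋` in `T_j`; it counts the solutions of `2 a + 3 b = n` in
natural numbers. -/
def mainMult (n : ℕ) : ℤ := ⌊(n : ℚ) / 2⌋ - ⌊((n : ℚ) - 1) / 3⌋

/-- The coefficient `⌊(n-j-1)/2⌋ + 1` in `T_j`; for `n ≥ j + 1` it counts the solutions of
`a + 2 b = n - j - 1` in natural numbers. -/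
def corrMult (j n : ℕ) : ℤ := ⌊((n : ℚ) - (j : ℚ) - 1) / 2⌋ + 1

lemma mainMult_eq (n : ℕ) : mainMult n = {t : ℕ × ℕ | 2 * t.1 + 3 * t.2 = n}.ncard := by
  have h1 : ⌊(n : ℚ) / 2⌋ = (n : ℤ) / 2 := by
    have := Rat.floor_intCast_div_natCast n 2
    simpa using this
  have h2 : ⌊((n : ℚ) - 1) / 3⌋ = ((n : ℤ) - 1) / 3 := by
    have := Rat.floor_intCast_div_natCast ((n : ℤ) - 1) 3
    simpa using this
  rw [mainMult, h1, h2, ncard_two_three, Nat.card_Icc]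
  omega

lemma corrMult_eq {j n : ℕ} (h : j + 1 ≤ n) :
    corrMult j n = {t : ℕ × ℕ | t.1 + 2 * t.2 = n - j - 1}.ncard := by
  have h1 : ⌊((n : ℚ) - (j : ℚ) - 1) / 2⌋ = ((n : ℤ) - j - 1) / 2 := by
    have := Rat.floor_intCast_div_natCast ((n : ℤ) - j - 1) 2
    simpa using this
  rw [corrMult, h1, ncard_one_two]
  omega

/-- The coordinates of `Sym^j(Sym^3(t₁, t₂))` in the basis `h_m(t₁, t₂) (t₁ t₂) ^ i`. -/
def symCubeCoord (j : ℕ) : ℕ × ℤ →₀ ℂ :=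
  ∑ n ∈ Finset.Icc 0 (3 * j / 2), Finsupp.single (3 * j - 2 * n, (n : ℤ)) (mainMult n : ℂ) -
    ∑ n ∈ Finset.Icc (j + 1) (3 * j / 2),
      Finsupp.single (3 * j - 2 * n, (n : ℤ)) (corrMult j n : ℂ)

lemma sum_single_coord_apply (j l : ℕ) (α : ℕ → ℂ) (m : ℕ) (i : ℤ) :
    (∑ n ∈ Finset.Icc l (3 * j / 2), Finsupp.single (3 * j - 2 * n, (n : ℤ)) (α n)) (m, i) =
      if (m : ℤ) + 2 * i = 3 * j ∧ (l : ℤ) ≤ i then α i.toNat else 0 := by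
  classical
  rw [Finsupp.finsetSum_apply]
  simp only [Finsupp.single_apply, Prod.mk.injEq]
  split_ifs with h
  · rw [Finset.sum_eq_single i.toNat]
    · rw [if_pos (by omega)]
    · intro n hn hne
      rw [Finset.mem_Icc] at hn
      rw [if_neg (by omega)]
    · intro hn
      rw [Finset.mem_Icc] at hn
      omega
  · refine Finset.sum_eq_zero fun n hn => ?_
    rw [Finset.mem_Icc] at hn
    rw [if_neg (by omega)]

theorem symSym_three_eq_schurSum (j : ℕ) :
    ((symSym j 3).coeff : ℤ × ℤ → ℂ) = schurSum 1 (symCubeCoord j) := by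
  refine eq_schurSum (fun a b => ?_) ?_ fun m i => ?_
  · rw [symSym_three_coeff, symSym_three_coeff, add_comm b a]
    split_ifs with h
    · rw [ncard_boxTriples_reflect, show 3 * (j : ℤ) - b = a by omega]
    · rfl
  · exact (symSym j 3).coeff.hasFiniteSupport
  · rw [symSym_three_coeff, symSym_three_coeff, symCubeCoord, Finsupp.sub_apply,
      sum_single_coord_apply, sum_single_coord_apply, Pi.one_apply, one_mul,
      show (m : ℤ) + i + 1 + (i - 1) = m + 2 * i by ring,
      show (m : ℤ) + i + i = m + 2 * i by ring]
    by_cases h : (m : ℤ) + 2 * i = 3 * j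
    · simp only [h, true_and, if_true]
      by_cases hi : 0 ≤ i
      · obtain ⟨n, rfl⟩ := Int.eq_ofNat_of_zero_le hi
        have key := ncard_boxTriples_sub j n (by omega)
        rw [← mainMult_eq] at key
        rw [if_pos (by simp), Int.toNat_natCast]
        split_ifs with hj
        · have hj' : j + 1 ≤ n := by exact_mod_cast hj
          rw [if_pos hj', ← corrMult_eq hj'] at key
          exact_mod_cast key
        · rw [if_neg (by exact_mod_cast hj)] at key
          exact_mod_cast key
      · have hempty : ∀ y : ℤ, y < 0 → (boxTriples j y).ncard = 0 := by
          intro y hy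
          refine (congrArg Set.ncard (Set.eq_empty_iff_forall_notMem.2 ?_)).trans
            (Set.ncard_empty _)
          rintro ⟨b, c, d⟩
          simp only [boxTriples, Set.mem_ofPred_eq]
          omega
        rw [hempty _ (by omega), hempty _ (by omega), if_neg (by simpa using hi),
          if_neg (by push_cast; omega)]
        simp
    · simp [h]

/-! ### The spherical Hecke algebra and the Satake transform -/

section Hecke

variable {F : Type*} [Field F] [ValuativeRel F]

/-- The function `𝟙_m * 𝟙_{i,i}`, where `k = (m, i)`, given as the characteristic function of its
support. -/
def basisFn (ϖ : Fˣ) (k : ℕ × ℤ) : GL (Fin 2) F → ℂ :=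
  Set.indicator (boundedSet ϖ k.2 (k.1 + 2 * k.2)) 1

/-- The combination `∑ c(m, i) 𝟙_m * 𝟙_{i,i}`. -/
def heckeSum (ϖ : Fˣ) : (ℕ × ℤ →₀ ℂ) →ₗ[ℂ] (GL (Fin 2) F → ℂ) :=
  Finsupp.linearCombination ℂ (basisFn ϖ)

lemma heckeSum_apply (ϖ : Fˣ) (c : ℕ × ℤ →₀ ℂ) (g : GL (Fin 2) F) :
    heckeSum ϖ c g = ∑ k ∈ c.support, c k * basisFn ϖ k g := by
  simp [heckeSum, Finsupp.linearCombination_apply, Finsupp.sum, Finset.sum_apply]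

lemma basisFn_bi_invariant (ϖ : Fˣ) (k : ℕ × ℤ) {k₁ k₂ : GL (Fin 2) F} (h₁ : k₁ ∈ maxCompact F)
    (h₂ : k₂ ∈ maxCompact F) (g : GL (Fin 2) F) :
    basisFn ϖ k (k₁ * g * k₂) = basisFn ϖ k g := by
  classical
  simp only [basisFn, Set.indicator_apply, mul_right_mem_boundedSet h₂, mul_left_mem_boundedSet h₁,
    Pi.one_apply]

lemma basisFn_diagGL {ϖ : Fˣ} (hϖ : IsUniformizer ϖ) (k : ℕ × ℤ) (a b : ℤ) :
    basisFn ϖ k (diagGL (ϖ ^ a) (ϖ ^ b)) = schurCoeff k (a, b) := by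
  classical
  simp only [basisFn, Set.indicator_apply, diagGL_mem_boundedSet hϖ, schurCoeff, Pi.one_apply]

lemma basisFn_diagGL_mul_unipotent {ϖ : Fˣ} (hϖ : IsUniformizer ϖ) (k : ℕ × ℤ) (a b : ℤ) :
    (fun x => basisFn ϖ k (diagGL (ϖ ^ a) (ϖ ^ b) * unipotent x)) =
      Set.indicator {x : F | valuation F x ≤ valuation F (ϖ : F) ^ (k.2 - a)}
        fun _ => schurCoeff k (a, b) := by
  classical
  funext x
  simp only [basisFn, Set.indicator_apply, diagGL_mul_unipotent_mem_boundedSet hϖ, schurCoeff,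
    Pi.one_apply, Set.mem_ofPred_eq]
  split_ifs <;> first | rfl | (exfalso; tauto)

lemma heckeSum_diagGL {ϖ : Fˣ} (hϖ : IsUniformizer ϖ) (c : ℕ × ℤ →₀ ℂ) (a b : ℤ) :
    heckeSum ϖ c (diagGL (ϖ ^ a) (ϖ ^ b)) = schurSum 1 c (a, b) := by
  simp [heckeSum_apply, schurSum_apply, basisFn_diagGL hϖ]

variable [TopologicalSpace F]

/-- The spherical Hecke algebra as a vector space. -/
def sphericalHeckeSubmodule (F : Type*) [Field F] [ValuativeRel F] [TopologicalSpace F] :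
    Submodule ℂ (GL (Fin 2) F → ℂ) where
  carrier := sphericalHecke F
  add_mem' {f f'} hf hf' := by
    refine ⟨⟨hf.1.1.add hf'.1.1, fun k₁ h₁ k₂ h₂ g => ?_⟩, hf.2.add hf'.2⟩
    rw [Pi.add_apply, Pi.add_apply, hf.1.2 _ h₁ _ h₂, hf'.1.2 _ h₁ _ h₂]
  zero_mem' := ⟨⟨IsLocallyConstant.const 0, fun _ _ _ _ _ => rfl⟩, HasCompactSupport.zero⟩
  smul_mem' z f hf := by
    refine ⟨⟨hf.1.1.comp (z • ·), fun k₁ h₁ k₂ h₂ g => ?_⟩, ?_⟩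
    · rw [Pi.smul_apply, Pi.smul_apply, hf.1.2 _ h₁ _ h₂]
    · exact hf.2.smul_left (f := fun _ => z)

variable [IsNonarchimedeanLocalField F]

lemma basisFn_mem_sphericalHecke {ϖ : Fˣ} (hϖ : IsUniformizer ϖ) (k : ℕ × ℤ) :
    basisFn ϖ k ∈ sphericalHecke F := by
  refine ⟨⟨?_, fun k₁ h₁ k₂ h₂ g => basisFn_bi_invariant ϖ k h₁ h₂ g⟩, ?_⟩
  · exact (LocallyConstant.indicator 1 (isClopen_boundedSet hϖ _ _)).isLocallyConstant
  · refine HasCompactSupport.intro (isCompact_boundedSet hϖ k.2 (k.1 + 2 * k.2)) fun g hg => ?_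
    exact Set.indicator_of_notMem hg _

lemma heckeSum_mem_sphericalHecke {ϖ : Fˣ} (hϖ : IsUniformizer ϖ) (c : ℕ × ℤ →₀ ℂ) :
    heckeSum ϖ c ∈ sphericalHecke F :=
  Submodule.sum_smul_mem (sphericalHeckeSubmodule F) _
    fun k _ => basisFn_mem_sphericalHecke hϖ k

lemma diagGL_support_finite {ϖ : Fˣ} (hϖ : IsUniformizer ϖ) {f : GL (Fin 2) F → ℂ}
    (hf : HasCompactSupport f) :
    (Function.support fun p : ℤ × ℤ => f (diagGL (ϖ ^ p.1) (ϖ ^ p.2))).Finite := by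
  obtain ⟨N, hN⟩ : ∃ N : ℕ, ∀ g ∈ tsupport f, ∀ r,
      valuation F ((g : Matrix (Fin 2) (Fin 2) F) r r) ≤ valuation F (ϖ : F) ^ (-(N : ℤ)) ∧
      valuation F (((g⁻¹ : GL (Fin 2) F) : Matrix (Fin 2) (Fin 2) F) r r) ≤
        valuation F (ϖ : F) ^ (-(N : ℤ)) := by
    have hS : IsCompact (⋃ r : Fin 2,
        (fun g : GL (Fin 2) F => (g : Matrix (Fin 2) (Fin 2) F) r r) '' tsupport f ∪
        (fun g : GL (Fin 2) F =>
          ((g⁻¹ : GL (Fin 2) F) : Matrix (Fin 2) (Fin 2) F) r r) '' tsupport f) :=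
      isCompact_iUnion fun r => (hf.isCompact.image (continuous_entry r r)).union
        (hf.isCompact.image ((continuous_entry r r).comp continuous_inv))
    obtain ⟨N, hN⟩ := exists_valuation_le_of_isCompact hϖ hS
    refine ⟨N, fun g hg r => ⟨hN _ ?_, hN _ ?_⟩⟩
    · exact Set.mem_iUnion.2 ⟨r, Or.inl ⟨g, hg, rfl⟩⟩
    · exact Set.mem_iUnion.2 ⟨r, Or.inr ⟨g, hg, rfl⟩⟩
  refine ((Set.finite_Icc (-(N : ℤ)) N).prod (Set.finite_Icc (-(N : ℤ)) N)).subset ?_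
  rintro ⟨a, b⟩ hp
  have h := hN _ (subset_tsupport _ hp)
  rw [diagGL_inv] at h
  have h0 : valuation F ((ϖ ^ a : Fˣ) : F) ≤ _ ∧ valuation F (((ϖ ^ a)⁻¹ : Fˣ) : F) ≤ _ := h 0
  have h1 : valuation F ((ϖ ^ b : Fˣ) : F) ≤ _ ∧ valuation F (((ϖ ^ b)⁻¹ : Fˣ) : F) ≤ _ := h 1
  simp only [← zpow_neg, Units.val_zpow_eq_zpow_val, map_zpow₀, valuation_zpow_le_iff hϖ]
    at h0 h1
  simp only [Set.mem_prod, Set.mem_Icc]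
  omega

/-- The functions `𝟙_m * 𝟙_{i,i}` span the spherical Hecke algebra: by the Cartan decomposition
a function is determined by its values on diagonal matrices, which are symmetric under the Weyl
element and almost all zero. -/
lemma exists_eq_heckeSum {ϖ : Fˣ} (hϖ : IsUniformizer ϖ) {f : GL (Fin 2) F → ℂ}
    (hf : f ∈ sphericalHecke F) : ∃ c, f = heckeSum ϖ c := by
  obtain ⟨c, hc⟩ := exists_eq_schurSum (w := 1) (fun _ => one_ne_zero)
    (P := fun p : ℤ × ℤ => f (diagGL (ϖ ^ p.1) (ϖ ^ p.2))) (fun a b => by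
      simp only
      rw [← weylGL_mul_diagGL_mul_weylGL, hf.1.2 _ weylGL_mem _ weylGL_mem])
    (diagGL_support_finite hϖ hf.2)
  refine ⟨c, eq_of_eq_on_diagGL hϖ hf.1.2 (heckeSum_mem_sphericalHecke hϖ c).1.2 fun a b => ?_⟩
  rw [heckeSum_diagGL hϖ, ← hc]

/-- The Satake transform of `𝟙_m * 𝟙_{i,i}` is `q ^ (m / 2) h_m(t₁, t₂) (t₁ t₂) ^ i`; this is the
scalar `q ^ (m / 2)`. -/
def satakeWeight (q : ℕ) (k : ℕ × ℤ) : ℂ := (((q : ℝ) ^ ((k.1 : ℝ) / 2) : ℝ) : ℂ)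

lemma satakeWeight_ne_zero {q : ℕ} (hq : 0 < q) (k : ℕ × ℤ) : satakeWeight q k ≠ 0 := by
  have : (0 : ℝ) < (q : ℝ) ^ ((k.1 : ℝ) / 2) := Real.rpow_pos_of_pos (by exact_mod_cast hq) _
  exact Complex.ofReal_ne_zero.2 this.ne'

variable [MeasurableSpace F] [BorelSpace F] (ν : Measure F) [ν.IsAddHaarMeasure]

lemma measurableSet_ball (ϖ : Fˣ) (n : ℤ) :
    MeasurableSet {x : F | valuation F x ≤ valuation F (ϖ : F) ^ n} :=
  (isClopen_valuation_le (zpow_ne_zero n (by simp))).2.measurableSet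

lemma integrable_basisFn {ϖ : Fˣ} (hϖ : IsUniformizer ϖ) (k : ℕ × ℤ) (a b : ℤ) :
    Integrable (fun x => basisFn ϖ k (diagGL (ϖ ^ a) (ϖ ^ b) * unipotent x)) ν := by
  rw [basisFn_diagGL_mul_unipotent hϖ, integrable_indicator_iff (measurableSet_ball ϖ _)]
  exact integrableOn_const
    (IsNonarchimedeanLocalField.isCompact_closedBall F _).measure_lt_top.ne

variable (hν : ν {x : F | x ∈ 𝒪[F]} = 1)

include hν in
lemma satake_basisFn {ϖ : Fˣ} (hϖ : IsUniformizer ϖ) (k : ℕ × ℤ) (p : ℤ × ℤ) :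
    satake ν ϖ (basisFn ϖ k) p = satakeWeight (residueCard F) k * schurCoeff k p := by
  obtain ⟨a, b⟩ := p
  rw [satake, basisFn_diagGL_mul_unipotent hϖ, integral_indicator_const _ (measurableSet_ball ϖ _),
    measureReal_ball ν hν hϖ, Complex.real_smul, ← mul_assoc, ← Complex.ofReal_mul]
  by_cases h : k.2 ≤ a ∧ k.2 ≤ b ∧ a + b = k.1 + 2 * k.2
  · congr 1
    rw [satakeWeight, ← Real.rpow_intCast, ← Real.rpow_add (by exact_mod_cast residueCard_pos F)]
    have h2 : (a : ℝ) + b = k.1 + 2 * k.2 := by exact_mod_cast h.2.2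
    congr 2
    push_cast
    linarith
  · rw [schurCoeff, if_neg h, mul_zero, mul_zero]

include hν in
lemma satake_heckeSum {ϖ : Fˣ} (hϖ : IsUniformizer ϖ) (c : ℕ × ℤ →₀ ℂ) :
    satake ν ϖ (heckeSum ϖ c) = schurSum (satakeWeight (residueCard F)) c := by
  funext p
  have h1 : satake ν ϖ (heckeSum ϖ c) p = ∑ k ∈ c.support, c k * satake ν ϖ (basisFn ϖ k) p := by
    simp only [satake, heckeSum_apply]
    rw [integral_finsetSum _ fun k _ => (integrable_basisFn ν hϖ k _ _).const_mul _,
      Finset.mul_sum]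
    refine Finset.sum_congr rfl fun k _ => ?_
    rw [integral_const_mul]
    ring
  rw [h1, schurSum_apply]
  simp only [satake_basisFn ν hν hϖ]

include hν in
lemma satake_injOn {ϖ : Fˣ} (hϖ : IsUniformizer ϖ) :
    Set.InjOn (satake ν ϖ) (sphericalHecke F) := by
  intro f hf f' hf' h
  obtain ⟨c, rfl⟩ := exists_eq_heckeSum hϖ hf
  obtain ⟨c', rfl⟩ := exists_eq_heckeSum hϖ hf'
  rw [satake_heckeSum ν hν hϖ, satake_heckeSum ν hν hϖ] at h
  rw [schurSum_injective (satakeWeight_ne_zero (residueCard_pos F)) h]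

include hν in
theorem satake_bijOn {ϖ : Fˣ} (hϖ : IsUniformizer ϖ) :
    Set.BijOn (satake ν ϖ) (sphericalHecke F)
      ((fun P : Laurent₂ => (P.coeff : ℤ × ℤ → ℂ)) '' symmetricLaurent) := by
  refine ⟨fun f hf => ?_, satake_injOn ν hν hϖ, ?_⟩
  · obtain ⟨c, rfl⟩ := exists_eq_heckeSum hϖ hf
    rw [satake_heckeSum ν hν hϖ]
    refine ⟨AddMonoidAlgebra.ofCoeff (Finsupp.ofSupportFinite _ (schurSum_support_finite
      (satakeWeight (residueCard F)) c)), fun a b => ?_, rfl⟩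
    exact schurSum_symm _ c a b
  · rintro _ ⟨P, hP, rfl⟩
    obtain ⟨c, hc⟩ := exists_eq_schurSum (satakeWeight_ne_zero (residueCard_pos F))
      hP P.coeff.hasFiniteSupport
    refine ⟨heckeSum ϖ c, heckeSum_mem_sphericalHecke hϖ c, ?_⟩
    rw [satake_heckeSum ν hν hϖ]
    exact hc.symm

include hν in
lemma satakeInv_eq_heckeSum {ϖ : Fˣ} (hϖ : IsUniformizer ϖ) {P : Laurent₂} {c : ℕ × ℤ →₀ ℂ}
    (h : (P.coeff : ℤ × ℤ → ℂ) = schurSum (satakeWeight (residueCard F)) c) :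
    satakeInv ν ϖ P = heckeSum ϖ c := by
  rw [satakeInv, h, ← satake_heckeSum ν hν hϖ]
  exact (satake_injOn ν hν hϖ).leftInvOn_invFunOn (heckeSum_mem_sphericalHecke hϖ c)

end Hecke

/-! ### The operators `T_j` -/

section Operators

variable {F : Type*} [Field F] [ValuativeRel F]

lemma charDouble_bi_invariant (x y : Fˣ) {k₁ k₂ : GL (Fin 2) F} (h₁ : k₁ ∈ maxCompact F)
    (h₂ : k₂ ∈ maxCompact F) (g : GL (Fin 2) F) :
    charDouble x y (k₁ * g * k₂) = charDouble x y g := by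
  classical
  have : k₁ * g * k₂ ∈ DoubleCoset.doubleCoset (diagGL x y) (maxCompact F) (maxCompact F) ↔
      g ∈ DoubleCoset.doubleCoset (diagGL x y) (maxCompact F) (maxCompact F) := by
    simp only [DoubleCoset.mem_doubleCoset]
    constructor
    · rintro ⟨l₁, hl₁, l₂, hl₂, h⟩
      refine ⟨k₁⁻¹ * l₁, mul_mem (inv_mem h₁) hl₁, l₂ * k₂⁻¹, mul_mem hl₂ (inv_mem h₂), ?_⟩
      calc g = k₁⁻¹ * (k₁ * g * k₂) * k₂⁻¹ := by group
        _ = _ := by rw [h]; group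
    · rintro ⟨l₁, hl₁, l₂, hl₂, rfl⟩
      exact ⟨k₁ * l₁, mul_mem h₁ hl₁, l₂ * k₂, mul_mem hl₂ h₂, by group⟩
  simp only [charDouble, Set.indicator_apply, this, Pi.one_apply]

/-- Distinct pairs `a ≥ b` give distinct double cosets, because the smallest valuation of an entry
and the valuation of the determinant are constant on a double coset. -/
lemma charDouble_diagGL {ϖ : Fˣ} (hϖ : IsUniformizer ϖ) {a b : ℤ} (hab : b ≤ a) (c d : ℤ) :
    charDouble (ϖ ^ a) (ϖ ^ b) (diagGL (ϖ ^ c) (ϖ ^ d)) =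
      if c = a ∧ d = b ∨ c = b ∧ d = a then 1 else 0 := by
  classical
  rw [charDouble, Set.indicator_apply, Pi.one_apply]
  refine if_congr ?_ rfl rfl
  rw [DoubleCoset.mem_doubleCoset]
  constructor
  · rintro ⟨k₁, h₁, k₂, h₂, h⟩
    have key : ∀ i e : ℤ, diagGL (ϖ ^ c) (ϖ ^ d) ∈ boundedSet ϖ i e ↔
        diagGL (ϖ ^ a) (ϖ ^ b) ∈ boundedSet ϖ i e := fun i e => by
      rw [h, mul_right_mem_boundedSet h₂, mul_left_mem_boundedSet h₁]
    simp only [diagGL_mem_boundedSet hϖ] at key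
    have h1 := (key b (a + b)).2 ⟨hab, le_rfl, rfl⟩
    have h2 := (key (min c d) (c + d)).1 ⟨min_le_left _ _, min_le_right _ _, rfl⟩
    omega
  · rintro (⟨rfl, rfl⟩ | ⟨rfl, rfl⟩)
    · exact ⟨1, one_mem _, 1, one_mem _, by simp⟩
    · exact ⟨weylGL F, weylGL_mem, weylGL F, weylGL_mem, (weylGL_mul_diagGL_mul_weylGL _ _).symm⟩

/-- The coordinates of `q ^ (-3j/2) T_j` in the basis `𝟙_m * 𝟙_{i,i}`. -/
def heckeTCoord (q j : ℕ) : ℕ × ℤ →₀ ℂ :=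
  (((q : ℝ) ^ (-(3 * (j : ℝ)) / 2) : ℝ) : ℂ) •
    (∑ n ∈ Finset.Icc 0 (3 * j / 2),
      Finsupp.single (3 * j - 2 * n, (n : ℤ)) ((mainMult n : ℂ) * (q : ℂ) ^ n) -
    ∑ n ∈ Finset.Icc (j + 1) (3 * j / 2),
      Finsupp.single (3 * j - 2 * n, (n : ℤ)) ((corrMult j n : ℂ) * (q : ℂ) ^ n))

lemma satakeWeight_mul_power {q : ℕ} (hq : 0 < q) {j n : ℕ} (hn : n ≤ 3 * j / 2) (z : ℂ) :
    (((q : ℝ) ^ (-(3 * (j : ℝ)) / 2) : ℝ) : ℂ) *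
      (z * (q : ℂ) ^ n * satakeWeight q (3 * j - 2 * n, n)) = z := by
  have h1 : (q : ℝ) ^ (-(3 * (j : ℝ)) / 2) *
      ((q : ℝ) ^ n * (q : ℝ) ^ (((3 * j - 2 * n : ℕ) : ℝ) / 2)) = 1 := by
    have hq' : (0 : ℝ) < q := by exact_mod_cast hq
    rw [← Real.rpow_natCast, ← Real.rpow_add hq', ← Real.rpow_add hq',
      Nat.cast_sub (by omega)]
    convert Real.rpow_zero (q : ℝ) using 2
    push_cast
    ring
  have h2 := congrArg (fun x : ℝ => (x : ℂ)) h1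
  push_cast at h2
  rw [satakeWeight]
  push_cast
  linear_combination z * h2

lemma schurSum_heckeTCoord {q : ℕ} (hq : 0 < q) (j : ℕ) :
    schurSum (satakeWeight q) (heckeTCoord q j) = schurSum 1 (symCubeCoord j) := by
  simp only [heckeTCoord, symCubeCoord, map_smul, map_sub, map_sum, schurSum,
    Finsupp.linearCombination_single, smul_sub, Finset.smul_sum, smul_smul, Pi.one_apply, one_smul]
  congr 1 <;>
  · refine Finset.sum_congr rfl fun n hn => ?_
    rw [satakeWeight_mul_power hq (Finset.mem_Icc.1 hn).2]

lemma valuation_det_of_heckeSum_ne_zero {ϖ : Fˣ} {j : ℕ} {g : GL (Fin 2) F}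
    (hg : heckeSum ϖ (heckeTCoord (residueCard F) j) g ≠ 0) :
    valuation F (g : Matrix (Fin 2) (Fin 2) F).det = valuation F (ϖ : F) ^ (3 * (j : ℤ)) := by
  by_contra hne
  refine hg ?_
  have h0 : ∀ n ≤ 3 * j / 2, basisFn ϖ (3 * j - 2 * n, (n : ℤ)) g = 0 := by
    intro n hn
    refine Set.indicator_of_notMem (fun h => hne ?_) _
    rw [h.2]
    congr 1
    push_cast
    omega
  simp only [heckeTCoord, map_smul, map_sub, map_sum, heckeSum, Finsupp.linearCombination_single,
    Pi.smul_apply, Pi.sub_apply, Finset.sum_apply]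
  rw [Finset.sum_eq_zero fun n hn => by rw [h0 n (Finset.mem_Icc.1 hn).2, smul_zero],
    Finset.sum_eq_zero fun n hn => by rw [h0 n (Finset.mem_Icc.1 hn).2, smul_zero],
    sub_zero, smul_zero]

variable [TopologicalSpace F] [IsNonarchimedeanLocalField F]

lemma oneM_eq_basisFn {ϖ : Fˣ} (hϖ : IsUniformizer ϖ) (m : ℕ) :
    oneM ϖ m = basisFn ϖ (m, 0) := by
  classical
  refine eq_of_eq_on_diagGL hϖ (fun k₁ h₁ k₂ h₂ g => ?_)
    (fun k₁ h₁ k₂ h₂ g => basisFn_bi_invariant ϖ _ h₁ h₂ g) fun c d => ?_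
  · simp only [oneM, Finset.sum_apply, charDouble_bi_invariant _ _ h₁ h₂]
  · rw [basisFn_diagGL hϖ, oneM, Finset.sum_apply, schurCoeff]
    have hterm : ∀ p ∈ (Finset.HasAntidiagonal.antidiagonal m).filter
        (fun p : ℕ × ℕ => p.2 ≤ p.1), charDouble (ϖ ^ p.1) (ϖ ^ p.2)
          (diagGL (ϖ ^ c) (ϖ ^ d)) = if c = p.1 ∧ d = p.2 ∨ c = p.2 ∧ d = p.1 then 1 else 0 := by
      intro p hp
      rw [Finset.mem_filter] at hp
      rw [← charDouble_diagGL hϖ (by exact_mod_cast hp.2), zpow_natCast, zpow_natCast]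
    rw [Finset.sum_congr rfl hterm]
    simp only [mul_zero, add_zero]
    split_ifs with h
    · rw [Finset.sum_eq_single ((max c d).toNat, (min c d).toNat)]
      · rw [if_pos (by simp only; omega)]
      · rintro ⟨a, b⟩ hp hne
        simp only [Finset.mem_filter, Finset.HasAntidiagonal.mem_antidiagonal, ne_eq,
          Prod.mk.injEq] at hp hne
        rw [if_neg (by simp only; omega)]
      · intro hp
        simp only [Finset.mem_filter, Finset.HasAntidiagonal.mem_antidiagonal] at hp
        omega
    · refine Finset.sum_eq_zero ?_
      rintro ⟨a, b⟩ hp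
      simp only [Finset.mem_filter, Finset.HasAntidiagonal.mem_antidiagonal] at hp
      rw [if_neg (by simp only; omega)]

lemma oneII_eq_basisFn {ϖ : Fˣ} (hϖ : IsUniformizer ϖ) (i : ℤ) :
    oneII ϖ i = basisFn ϖ (0, i) := by
  refine eq_of_eq_on_diagGL hϖ (fun k₁ h₁ k₂ h₂ g => charDouble_bi_invariant _ _ h₁ h₂ g)
    (fun k₁ h₁ k₂ h₂ g => basisFn_bi_invariant ϖ _ h₁ h₂ g) fun c d => ?_
  rw [basisFn_diagGL hϖ, oneII, charDouble_diagGL hϖ le_rfl, schurCoeff]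
  refine if_congr ?_ rfl rfl
  push_cast
  omega

variable [MeasurableSpace (GL (Fin 2) F)] [BorelSpace (GL (Fin 2) F)]
  (μ : Measure (GL (Fin 2) F)) [μ.IsHaarMeasure]

/-- Convolution with `𝟙_{i,i}` is translation by the central element `ϖ ^ i`. -/
lemma conv_oneM_oneII (hμ : μ (maxCompact F : Set (GL (Fin 2) F)) = 1) {ϖ : Fˣ}
    (hϖ : IsUniformizer ϖ) (m : ℕ) (i : ℤ) :
    conv μ (oneM ϖ m) (oneII ϖ i) = basisFn ϖ (m, i) := by
  classical
  funext g
  set z : GL (Fin 2) F := diagGL (ϖ ^ (-i)) (ϖ ^ (-i)) with hz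
  have hz1 : z ∈ boundedSet ϖ (-i) (-(2 * i)) :=
    (diagGL_mem_boundedSet hϖ).2 ⟨le_rfl, le_rfl, by ring⟩
  have hz2 : z⁻¹ ∈ boundedSet ϖ i (2 * i) := by
    have := inv_mem_boundedSet hz1
    convert this using 2 <;> ring
  have hK : ∀ h : GL (Fin 2) F, h ∈ boundedSet ϖ i (2 * i) ↔ h * z ∈ maxCompact F := by
    intro h
    rw [mem_maxCompact_iff ϖ]
    constructor
    · intro hh
      convert mul_mem_boundedSet hh hz1 using 2 <;> ring
    · intro hh
      have := mul_mem_boundedSet hh hz2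
      rw [mul_inv_cancel_right] at this
      convert this using 2 <;> ring
  let S : Set (GL (Fin 2) F) := (fun y => (g * z)⁻¹ * y) ⁻¹' (maxCompact F : Set (GL (Fin 2) F))
  have hS : ∀ y, y⁻¹ * g ∈ boundedSet ϖ i (2 * i) ↔ y ∈ S := by
    intro y
    rw [hK]
    change _ ↔ (g * z)⁻¹ * y ∈ maxCompact F
    rw [← inv_mem_iff]
    have : (y⁻¹ * g * z)⁻¹ = (g * z)⁻¹ * y := by group
    rw [this]
  have hKmeas : MeasurableSet (maxCompact F : Set (GL (Fin 2) F)) := by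
    have : (maxCompact F : Set (GL (Fin 2) F)) = boundedSet ϖ 0 0 :=
      Set.ext fun k => mem_maxCompact_iff ϖ
    rw [this]
    exact (isClopen_boundedSet hϖ 0 0).2.measurableSet
  have hSmeas : MeasurableSet S := (measurable_const_mul _) hKmeas
  have hSμ : μ S = 1 := by rw [measure_preimage_mul, hμ]
  have hint : (fun y => oneM ϖ m y * oneII ϖ i (y⁻¹ * g)) =
      S.indicator fun _ => basisFn ϖ (m, i) g := by
    funext y
    rw [oneM_eq_basisFn hϖ, oneII_eq_basisFn hϖ]
    simp only [basisFn, Set.indicator_apply, Pi.one_apply, Nat.cast_zero, zero_add, mul_zero,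
      add_zero, hS]
    by_cases hy : y ∈ S
    · rw [if_pos hy, if_pos hy, mul_one]
      refine if_congr ?_ rfl rfl
      have hy' := (hS y).2 hy
      constructor
      · intro h
        have := mul_mem_boundedSet h hy'
        rw [mul_inv_cancel_left] at this
        convert this using 2
        ring
      · intro h
        have := mul_mem_boundedSet h (inv_mem_boundedSet hy')
        have e : g * (y⁻¹ * g)⁻¹ = y := by group
        rw [e] at this
        convert this using 2 <;> ring
    · rw [if_neg hy, if_neg hy, mul_zero]
  rw [conv, hint, integral_indicator_const _ hSmeas, Measure.real, hSμ]
  simp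

lemma smul_heckeT_eq_heckeSum (hμ : μ (maxCompact F : Set (GL (Fin 2) F)) = 1) {ϖ : Fˣ}
    (hϖ : IsUniformizer ϖ) (j : ℕ) :
    (((residueCard F : ℝ) ^ (-(3 * (j : ℝ)) / 2) : ℝ) : ℂ) • heckeT μ ϖ j =
      heckeSum ϖ (heckeTCoord (residueCard F) j) := by
  simp only [heckeTCoord, map_smul, map_sub, map_sum, heckeSum, Finsupp.linearCombination_single,
    heckeT, conv_oneM_oneII μ hμ hϖ, mainMult, corrMult]

end Operators

/-! ### Almost compactly supported sums -/

section AlmostCompact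

variable {F : Type*} [Field F] [ValuativeRel F] [TopologicalSpace F] [IsNonarchimedeanLocalField F]

lemma exists_valuation_mem_Icc_of_isCompact {ϖ : Fˣ} (hϖ : IsUniformizer ϖ) {C : Set Fˣ}
    (hC : IsCompact C) : ∃ N : ℕ, ∀ x ∈ C, ∀ n : ℤ,
      valuation F (x : F) = valuation F (ϖ : F) ^ n → n ∈ Set.Icc (-(N : ℤ)) N := by
  obtain ⟨N, hN⟩ := exists_valuation_le_of_isCompact hϖ (hC.image Units.continuous_val)
  obtain ⟨N', hN'⟩ := exists_valuation_le_of_isCompact hϖ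
    (hC.image (Units.continuous_val.comp continuous_inv))
  refine ⟨max N N', fun x hx n hn => ?_⟩
  have h1 := hN _ ⟨x, hx, rfl⟩
  have h2 := hN' _ ⟨x, hx, rfl⟩
  rw [hn, valuation_zpow_le_iff hϖ] at h1
  rw [Function.comp_apply, Units.val_inv_eq_inv_val, map_inv₀, hn, ← zpow_neg,
    valuation_zpow_le_iff hϖ] at h2
  rw [Set.mem_Icc]
  push_cast
  omega

variable {ϖ : Fˣ} (hϖ : IsUniformizer ϖ) {f : ℕ → GL (Fin 2) F → ℂ} {d : ℕ → ℤ}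
  (hd : Function.Injective d)
  (hf : ∀ j g, f j g ≠ 0 →
    valuation F (g : Matrix (Fin 2) (Fin 2) F).det = valuation F (ϖ : F) ^ d j)

include hϖ hd hf

/-- Functions supported on pairwise distinct valuations of the determinant form an almost
compactly supported series. -/
lemma isAcSum_finsum : IsAcSum f fun g => ∑ᶠ j, f j g := by
  refine ⟨fun C hC => ?_, fun g => rfl⟩
  obtain ⟨N, hN⟩ := exists_valuation_mem_Icc_of_isCompact hϖ hC
  refine ((Set.finite_Icc (-(N : ℤ)) N).preimage hd.injOn).subset ?_
  rintro j ⟨g, hg, hne⟩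
  exact hN _ hg _ (hf j g hne)

lemma finsum_mem_acSphericalHecke (hmem : ∀ j, f j ∈ sphericalHecke F) :
    (fun g => ∑ᶠ j, f j g) ∈ acSphericalHecke F := by
  set L : GL (Fin 2) F → ℂ := fun g => ∑ᶠ j, f j g with hL
  -- On the matrices with determinant of valuation `n`, the sum has at most one nonzero term.
  have hlocal : ∀ n : ℤ, ∃ G ∈ sphericalHecke F, ∀ g : GL (Fin 2) F,
      valuation F (g : Matrix (Fin 2) (Fin 2) F).det = valuation F (ϖ : F) ^ n → L g = G g := by
    intro n
    by_cases hn : ∃ j, d j = n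
    · obtain ⟨j, rfl⟩ := hn
      refine ⟨f j, hmem j, fun g hg => finsum_eq_single _ _ fun j' hj' => ?_⟩
      by_contra hne
      have := hf j' g hne
      rw [hg, valuation_zpow_inj hϖ] at this
      exact hj' (hd this.symm)
    · refine ⟨0, (sphericalHeckeSubmodule F).zero_mem, fun g hg => ?_⟩
      rw [hL, Pi.zero_apply]
      refine finsum_eq_zero_of_forall_eq_zero fun j => ?_
      by_contra hne
      have := hf j g hne
      rw [hg, valuation_zpow_inj hϖ] at this
      exact hn ⟨j, this.symm⟩
  choose G hG hLG using hlocal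
  have hdet : ∀ g : GL (Fin 2) F, ∃ n : ℤ,
      valuation F (g : Matrix (Fin 2) (Fin 2) F).det = valuation F (ϖ : F) ^ n :=
    fun g => exists_valuation_eq_zpow hϖ (Matrix.GeneralLinearGroup.det_ne_zero g)
  have hnhds : ∀ (g : GL (Fin 2) F) (n : ℤ),
      valuation F (g : Matrix (Fin 2) (Fin 2) F).det = valuation F (ϖ : F) ^ n →
        L =ᶠ[nhds g] G n := fun g n hg =>
    Filter.eventually_of_mem ((isClopen_valuation_det_eq hϖ n).2.mem_nhds hg) fun g' hg' =>
      hLG n g' hg'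
  refine ⟨⟨?_, fun k₁ h₁ k₂ h₂ g => ?_⟩, fun C hC => ?_⟩
  · rw [IsLocallyConstant.iff_eventually_eq]
    intro g
    obtain ⟨n, hn⟩ := hdet g
    filter_upwards [hnhds g n hn, (hG n).1.1.eventually_eq g] with g' h1 h2
    rw [h1, h2, hLG n g hn]
  · exact finsum_congr fun j => (hmem j).1.2 k₁ h₁ k₂ h₂ g
  · obtain ⟨N, hN⟩ := exists_valuation_mem_Icc_of_isCompact hϖ hC
    refine ((Set.finite_Icc (-(N : ℤ)) N).isCompact_biUnion
      fun n _ => (hG n).2.isCompact).of_isClosed_subset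
        ((isClosed_tsupport L).inter (hC.isClosed.preimage ?_)) ?_
    · exact Matrix.GeneralLinearGroup.continuous_det
    · rintro g ⟨hg, hgC⟩
      obtain ⟨n, hn⟩ := hdet g
      refine Set.mem_biUnion (hN _ hgC n hn) ?_
      by_contra hout
      rw [notMem_tsupport_iff_eventuallyEq] at hout
      exact notMem_tsupport_iff_eventuallyEq.2 ((hnhds g n hn).trans hout) hg

end AlmostCompact

end SymPowerBasic

end

theorem mainTheorem5 {F : Type*} [Field F] [ValuativeRel F] [TopologicalSpace F]
    [IsNonarchimedeanLocalField F]
    [MeasurableSpace F] [BorelSpace F]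
    [MeasurableSpace (GL (Fin 2) F)] [BorelSpace (GL (Fin 2) F)]
    (ν : Measure F) [ν.IsAddHaarMeasure] (hν : ν {x : F | x ∈ 𝒪[F]} = 1)
    (μ : Measure (GL (Fin 2) F)) [μ.IsHaarMeasure]
    (hμ : μ (SymPowerBasic.maxCompact F : Set (GL (Fin 2) F)) = 1)
    (ϖ : Fˣ) (hϖ : SymPowerBasic.IsUniformizer ϖ) :
    -- the Satake transform is a bijection onto the symmetric Laurent polynomials,
    -- so that its inverse is meaningful
    Set.BijOn (SymPowerBasic.satake ν ϖ) (SymPowerBasic.sphericalHecke F)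
      ((fun P : SymPowerBasic.Laurent₂ => (P.coeff : ℤ × ℤ → ℂ)) ''
        SymPowerBasic.symmetricLaurent) ∧
    -- the series defining the basic function converges, to an almost compactly supported function
    SymPowerBasic.IsAcSum
      (fun j => SymPowerBasic.satakeInv ν ϖ (SymPowerBasic.symSym j 3))
      (SymPowerBasic.basicFunction ν ϖ 3) ∧
    SymPowerBasic.basicFunction ν ϖ 3 ∈ SymPowerBasic.acSphericalHecke F ∧
    -- the explicit formula
    SymPowerBasic.IsAcSum
      (fun j => (((SymPowerBasic.residueCard F : ℝ) ^ (-(3 * (j : ℝ)) / 2) : ℝ) : ℂ) •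
        SymPowerBasic.heckeT μ ϖ j)
      (SymPowerBasic.basicFunction ν ϖ 3) := by
  have hterm : ∀ j, SymPowerBasic.satakeInv ν ϖ (SymPowerBasic.symSym j 3) =
      SymPowerBasic.heckeSum ϖ (SymPowerBasic.heckeTCoord (SymPowerBasic.residueCard F) j) :=
    fun j => SymPowerBasic.satakeInv_eq_heckeSum ν hν hϖ (by
      rw [SymPowerBasic.symSym_three_eq_schurSum,
        SymPowerBasic.schurSum_heckeTCoord (SymPowerBasic.residueCard_pos F)])
  have hinj : Function.Injective fun j : ℕ => 3 * (j : ℤ) := fun j j' h => by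
    simp only at h
    omega
  have hL : SymPowerBasic.basicFunction ν ϖ 3 = fun g => ∑ᶠ j, SymPowerBasic.heckeSum ϖ
      (SymPowerBasic.heckeTCoord (SymPowerBasic.residueCard F) j) g := by
    funext g
    exact finsum_congr fun j => congrFun (hterm j) g
  have hsum := SymPowerBasic.isAcSum_finsum hϖ hinj
    fun j g => SymPowerBasic.valuation_det_of_heckeSum_ne_zero (ϖ := ϖ) (j := j) (g := g)
  refine ⟨SymPowerBasic.satake_bijOn ν hν hϖ, ?_, ?_, ?_⟩
  · rw [hL, funext hterm]
    exact hsum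
  · rw [hL]
    exact SymPowerBasic.finsum_mem_acSphericalHecke hϖ hinj
      (fun j g => SymPowerBasic.valuation_det_of_heckeSum_ne_zero)
      fun j => SymPowerBasic.heckeSum_mem_sphericalHecke hϖ _
  · rw [hL, funext fun j => SymPowerBasic.smul_heckeT_eq_heckeSum μ hμ hϖ j]
    exact hsum
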